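/- All graphs are finite and simple. An EPT representation of a graph $G$ consists of a (finite) host tree $T$ and a family $(P_v)_{v\in V(G)}$ of paths of $T$ such that two distinct vertices $v,w$ of $G$ are adjacent if and only if $E(P_v)\cap E(P_w)\neq\emptyset$. The representation is Helly if the family $(E(P_v))_{v\in V(G)}$ has the Helly property: every nonempty pairwise intersecting subfamily has nonempty total intersection. $G$ is a Helly EPT graph if it has a Helly EPT representation, and $G$ belongs to Helly $[h,2,2]$ if it has a Helly EPT representation on a host tree of maximum degree $h$. A clique is an inclusion-maximal set of pairwise adjacent vertices. Gates are the graphs obtained (up to isomorphism) as follows: every chordless cycle $C_n$ with $n\ge 4$ is a gate; if $H$ is a gate, $C$ and $C'$ are disjoint cliques of $H$, and $(v_1,\dots,v_l)$ with $l\ge 2$ is a chordless path disjoint from $H$, then the union of $H$ and the path, plus all edges between $v_1$ and the vertices of $C$ and all edges between $v_l$ and the vertices of $C'$, is a gate; there are no other gates. A $k$-gate is a gate with exactly $k$ cliques. Theorem. Let $G$ be a Helly EPT graph and let $h\ge 3$ be an integer. Then $G$ does not belong to Helly $[h,2,2]$ if and only if there is an integer $k>h$ such that $G$ has a $k$-gate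 as an induced subgraph. -/

import Mathlib

universe u v

/-- The Helly property of a set family: every nonempty pairwise intersecting subfamily has
nonempty total intersection. -/
def HellyProperty {ι : Type u} {α : Type v} (S : ι → Set α) : Prop :=
  ∀ I : Set ι, I.Nonempty → (I.Pairwise fun i j => (S i ∩ S j).Nonempty) →
    (⋂ i ∈ I, S i).Nonempty

/-- An EPT representation of `G` on the host graph `T` (used for trees `T`): a path `P v` of `T`
for each vertex `v` of `G`, such that two distinct vertices of `G` are adjacent if and only if
their paths share an edge of `T`. -/
structure EPTRepresentation {V : Type u} {W : Type v} (G : SimpleGraph V) (T : SimpleGraph W) where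
  /-- One end of the path of a vertex. -/
  src : V → W
  /-- The other end of the path of a vertex. -/
  tgt : V → W
  /-- The path of a vertex. -/
  path : ∀ x : V, T.Path (src x) (tgt x)
  adj_iff : ∀ x y : V, x ≠ y →
    (G.Adj x y ↔ ((path x).1.edgeSet ∩ (path y).1.edgeSet).Nonempty)

/-- The family of the edge sets of the paths has the Helly property. -/
def EPTRepresentation.IsHelly {V : Type u} {W : Type v} {G : SimpleGraph V} {T : SimpleGraph W}
    (R : EPTRepresentation G T) : Prop :=
  HellyProperty fun x : V => (R.path x).1.edgeSet

/-- `G` is a Helly EPT graph: it has a Helly EPT representation on some finite host tree. -/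
def IsHellyEPT {V : Type u} (G : SimpleGraph V) : Prop :=
  ∃ (W : Type) (_ : Fintype W) (T : SimpleGraph W),
    T.IsTree ∧ ∃ R : EPTRepresentation G T, R.IsHelly

open Classical in
/-- `G` belongs to Helly `[h,2,2]`: it has a Helly EPT representation on some finite host tree
of maximum degree `h`. -/
def IsHellyEPTOfMaxDegree {V : Type u} (G : SimpleGraph V) (h : ℕ) : Prop :=
  ∃ (W : Type) (_ : Fintype W) (T : SimpleGraph W),
    T.IsTree ∧ T.maxDegree = h ∧ ∃ R : EPTRepresentation G T, R.IsHelly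

/-- The disjoint union of `G` and the chordless path on `l` vertices `0, 1, …, l - 1`, plus all
edges between the first vertex of the path and `C` and all edges between the last vertex of the
path and `C'`. -/
def attachPath {V : Type u} (G : SimpleGraph V) (C C' : Set V) (l : ℕ) :
    SimpleGraph (V ⊕ Fin l) :=
  (G ⊕g SimpleGraph.pathGraph l) ⊔
    SimpleGraph.fromRel fun x y => ∃ (a : V) (i : Fin l), x = Sum.inl a ∧ y = Sum.inr i ∧
      ((i.val = 0 ∧ a ∈ C) ∨ (i.val + 1 = l ∧ a ∈ C'))

/-- Gates (up to isomorphism): chordless cycles of length at least 4, and what is obtained from a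
gate by attaching a chordless path with at least two vertices to two disjoint cliques, where a
clique is an inclusion-maximal complete set. -/
inductive IsGate : ∀ {V : Type u}, SimpleGraph V → Prop
  | cycle {V : Type u} (G : SimpleGraph V) (n : ℕ) (hn : 4 ≤ n)
      (e : G ≃g SimpleGraph.cycleGraph n) : IsGate G
  | attach {U V : Type u} (H : SimpleGraph U) (hH : IsGate H) (C C' : Set U)
      (hC : Maximal H.IsClique C) (hC' : Maximal H.IsClique C') (hdisj : Disjoint C C')
      (l : ℕ) (hl : 2 ≤ l) (G : SimpleGraph V) (e : G ≃g attachPath H C C' l) : IsGate G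

/-- A `k`-gate: a gate with exactly `k` (inclusion-maximal) cliques. -/
def IsKGate {V : Type u} (k : ℕ) (G : SimpleGraph V) : Prop :=
  IsGate G ∧ {C : Set V | Maximal G.IsClique C}.ncard = k

/-!
At a vertex `q` of the host tree, form the link graph on the neighbors of `q`: every path through
`q` joins the two neighbors that it visits. The paths through the edge from `q` to a neighbor are
pairwise adjacent, and by the Helly property every clique has a common direction at `q`.

Suppose that `q` has degree greater than `h`. If the link graph has a cut vertex `a`, then `q` can
be split into two adjacent vertices such that all paths through the new edge also pass through `a`;
this keeps the representation Helly and replaces `q` by two vertices of smaller degree. Otherwise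
the link graph is two-connected. A minimal two-connected subfamily of the paths through `q` is built
from a cycle by adding ears, and minimality makes the ears chordless, so that the family induces a
gate whose cliques correspond to the neighbors of `q`.

Conversely, in a Helly representation of a gate all paths pass through one vertex `q` of the host
tree, and distinct cliques of the gate correspond to distinct neighbors of `q`: along a cycle or an
attached path, the direction from `q` in which consecutive paths meet changes at every step,
because paths that are not consecutive share no edge at `q`.
-/

namespace HellyEPT

open SimpleGraph

section Branches

variable {W : Type v} {T : SimpleGraph W}

/-- The edges separating `s` from `t`. In a tree these are the edges of the path from `s` to `t`,
but this description does not choose a walk. -/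
def between (T : SimpleGraph W) (s t : W) : Set (Sym2 W) :=
  {e ∈ T.edgeSet | ¬ (T.deleteEdges {e}).Reachable s t}

theorem between_comm (s t : W) : between T s t = between T t s := by
  ext e
  simp only [between, Set.mem_ofPred_eq, reachable_comm]

theorem edgeSet_eq_between (hT : T.IsTree) {s t : W} {p : T.Walk s t} (hp : p.IsPath) :
    p.edgeSet = between T s t := by
  ext e
  constructor
  · refine fun he => ⟨p.edges_subset_edgeSet he, fun h => ?_⟩
    obtain ⟨r, hr⟩ := h.exists_isPath
    obtain rfl : p = r.mapLe (deleteEdges_le _) :=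
      (hT.existsUnique_path s t).unique hp (hr.mapLe _)
    have her : e ∈ r.edges := by simpa only [Walk.mem_edgeSet, Walk.edges_mapLe_eq_edges] using he
    simpa using r.edges_subset_edgeSet her
  · rintro ⟨-, h⟩
    by_contra he
    exact h ⟨p.toDeleteEdge e he⟩

theorem exists_mem_ne_of_mem_edgeSet {g : Sym2 W} (hg : g ∈ T.edgeSet) (q : W) :
    ∃ u ∈ g, u ≠ q := by
  induction g with
  | h a b =>
    by_cases ha : a = q
    · exact ⟨b, Sym2.mem_mk_right a b, fun hb => hg.ne (ha.trans hb.symm)⟩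
    · exact ⟨a, Sym2.mem_mk_left a b, ha⟩

/-- The neighbor of `q` in the direction of `w` in a tree; it is `q` itself if `w = q`. -/
noncomputable def branch (hT : T.IsTree) (q w : W) : W :=
  (hT.connected.exists_isPath q w).choose.snd

theorem branch_eq_snd (hT : T.IsTree) {q w : W} {p : T.Walk q w} (hp : p.IsPath) :
    branch hT q w = p.snd := by
  have h := hT.connected.exists_isPath q w
  rw [branch, (hT.existsUnique_path q w).unique hp h.choose_spec]

theorem branch_self (hT : T.IsTree) (q : W) : branch hT q q = q :=
  branch_eq_snd hT Walk.IsPath.nil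

theorem branch_of_adj (hT : T.IsTree) {q y : W} (h : T.Adj q y) : branch hT q y = y :=
  branch_eq_snd hT (p := h.toWalk) (Walk.IsPath.of_adj h)

theorem adj_branch (hT : T.IsTree) {q w : W} (hw : w ≠ q) : T.Adj q (branch hT q w) :=
  Walk.adj_snd (Walk.not_nil_of_ne hw.symm)

theorem branch_eq_of_mem_support (hT : T.IsTree) {q u w : W} {p : T.Walk q w} (hp : p.IsPath)
    (hu : u ∈ p.support) (huq : u ≠ q) : branch hT q u = branch hT q w := by
  classical
  rw [branch_eq_snd hT hp, branch_eq_snd hT (hp.takeUntil hu), Walk.snd_takeUntil huq]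

theorem branch_eq_of_adj (hT : T.IsTree) {q x y : W} (hx : x ≠ q) (hy : y ≠ q)
    (h : T.Adj x y) : branch hT q x = branch hT q y := by
  obtain ⟨p, hp⟩ := hT.connected.exists_isPath q x
  by_cases hyp : y ∈ p.support
  · exact (branch_eq_of_mem_support hT hp hyp hy).symm
  · refine branch_eq_of_mem_support hT (hp.concat hyp h) ?_ hx
    simp only [Walk.support_concat, List.mem_append, Walk.end_mem_support,
      true_or]

theorem reachable_deleteEdges_of_branch_ne (hT : T.IsTree) {q u w : W} {g : Sym2 W} (hu : u ∈ g)
    (huq : u ≠ q) (h : branch hT q w ≠ branch hT q u) :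
    (T.deleteEdges {g}).Reachable q w := by
  obtain ⟨p, hp⟩ := hT.connected.exists_isPath q w
  refine ⟨p.toDeleteEdge g fun hg => h ?_⟩
  exact (branch_eq_of_mem_support hT hp (p.mem_support_of_mem_edges hg hu) huq).symm

theorem reachable_deleteIncidenceSet_branch (hT : T.IsTree) (q w : W) :
    (T.deleteIncidenceSet q).Reachable (branch hT q w) w := by
  obtain ⟨p, hp⟩ := hT.connected.exists_isPath q w
  rw [branch_eq_snd hT hp]
  cases p with
  | nil => rfl
  | cons h r =>
    rw [Walk.snd_cons]
    exact ⟨r.toDeleteEdges _ fun e he heq =>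
      ((Walk.cons_isPath_iff h r).1 hp).2 (r.mem_support_of_mem_edges he heq.2)⟩

theorem mk_mem_between_iff (hT : T.IsTree) {q y s t : W} (hy : T.Adj q y) :
    s(q, y) ∈ between T s t ↔ ¬ (branch hT q s = y ↔ branch hT q t = y) := by
  have hout {w} (hw : branch hT q w ≠ y) : (T.deleteEdges {s(q, y)}).Reachable q w :=
    reachable_deleteEdges_of_branch_ne hT (Sym2.mem_mk_right q y) hy.ne'
      (by rwa [branch_of_adj hT hy])
  have hin {w} (hw : branch hT q w = y) : (T.deleteEdges {s(q, y)}).Reachable y w := by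
    rw [← hw]
    exact (reachable_deleteIncidenceSet_branch hT q w).mono
      (deleteEdges_anti (Set.singleton_subset_iff.2
        (T.mk'_mem_incidenceSet_left_iff.2 (hw ▸ hy))))
  constructor
  · rintro ⟨-, h⟩ hst
    by_cases hs : branch hT q s = y
    · exact h ((hin hs).symm.trans (hin (hst.1 hs)))
    · exact h ((hout hs).symm.trans (hout fun ht => hs (hst.2 ht)))
  · refine fun h => ⟨hy, fun hr => h ?_⟩
    have hq : ¬ (T.deleteEdges {s(q, y)}).Reachable q y :=
      isBridge_iff.1 (isAcyclic_iff_forall_adj_isBridge.1 hT.isAcyclic hy)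
    have hiff {w} : branch hT q w = y ↔ (T.deleteEdges {s(q, y)}).Reachable y w :=
      ⟨hin, fun h => by_contra fun hw => hq ((hout hw).trans h.symm)⟩
    exact hiff.trans ((⟨fun h => h.trans hr, fun h => h.trans hr.symm⟩ : _ ↔ _).trans hiff.symm)

theorem branch_eq_or_of_mem_between (hT : T.IsTree) {q s t u : W} {g : Sym2 W}
    (hg : g ∈ between T s t) (hu : u ∈ g) (huq : u ≠ q) :
    branch hT q s = branch hT q u ∨ branch hT q t = branch hT q u := by
  by_contra! hc
  exact hg.2 ((reachable_deleteEdges_of_branch_ne hT hu huq hc.1).symm.trans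
    (reachable_deleteEdges_of_branch_ne hT hu huq hc.2))

end Branches

section LocalStar

variable {V : Type u} {U : Type*} {W : Type v} {G : SimpleGraph V} {vis inc : V → W → Prop}

/-- `v` is incident with two different points. -/
def Through (inc : V → W → Prop) (v : V) : Prop := ∃ y z, y ≠ z ∧ inc v y ∧ inc v z

/-- The points incident with a member of `S`. -/
def points (inc : V → W → Prop) (S : Set V) : Set W := {y | ∃ v ∈ S, inc v y}

/-- What a Helly representation of `G` looks like near a vertex of the host tree. The points are
the edges at that vertex; `inc v y` says that the path of `v` contains the edge `y`, and `vis v y`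
that it contains some edge on the other side of `y` or `y` itself. -/
structure LocalStar (G : SimpleGraph V) (vis inc : V → W → Prop) : Prop where
  vis_of_inc : ∀ {v y}, inc v y → vis v y
  inc_of_vis : ∀ {v y z}, vis v y → vis v z → y ≠ z → inc v y
  eq_or_eq : ∀ {v x y z}, inc v x → inc v y → x ≠ y → vis v z → z = x ∨ z = y
  adj_of_inc : ∀ {v w y}, v ≠ w → inc v y → inc w y → G.Adj v w
  helly : ∀ Q : Set V, Q.Nonempty → G.IsClique Q → ∃ y, ∀ v ∈ Q, vis v y

namespace LocalStar

theorem comap {H : SimpleGraph U} (h : LocalStar G vis inc) (f : H ↪g G) :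
    LocalStar H (fun v => vis (f v)) (fun v => inc (f v)) where
  vis_of_inc := h.vis_of_inc
  inc_of_vis := h.inc_of_vis
  eq_or_eq := h.eq_or_eq
  adj_of_inc hvw hv hw := f.map_adj_iff.1 (h.adj_of_inc (f.injective.ne hvw) hv hw)
  helly Q hQ hQc := by
    obtain ⟨y, hy⟩ := h.helly (f '' Q) (hQ.image f) <| by
      rintro _ ⟨v, hv, rfl⟩ _ ⟨w, hw, rfl⟩ hne
      exact f.map_adj_iff.2 (hQc hv hw fun h => hne (congrArg f h))
    exact ⟨y, fun v hv => hy (f v) ⟨v, hv, rfl⟩⟩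

theorem inc_of_through (h : LocalStar G vis inc) {v : V} {y : W} (hv : Through inc v)
    (hy : vis v y) : inc v y := by
  obtain ⟨x, z, hxz, hx, hz⟩ := hv
  rcases h.eq_or_eq hx hz hxz hy with rfl | rfl <;> assumption

theorem exists_vis_of_adj (h : LocalStar G vis inc) {v w : V} (hvw : G.Adj v w) :
    ∃ y, vis v y ∧ vis w y := by
  obtain ⟨y, hy⟩ := h.helly {v, w} (Set.insert_nonempty _ _)
    (isClique_pair.2 fun _ => hvw)
  exact ⟨y, hy v (Set.mem_insert _ _), hy w (Set.mem_insert_of_mem _ rfl)⟩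

theorem adj_iff (h : LocalStar G vis inc) {v w : V} (hvw : v ≠ w) (hv : Through inc v)
    (hw : Through inc w) : G.Adj v w ↔ ∃ y, inc v y ∧ inc w y := by
  constructor
  · intro hadj
    obtain ⟨y, hvy, hwy⟩ := h.exists_vis_of_adj hadj
    exact ⟨y, h.inc_of_through hv hvy, h.inc_of_through hw hwy⟩
  · rintro ⟨y, hvy, hwy⟩
    exact h.adj_of_inc hvw hvy hwy

theorem isClique (h : LocalStar G vis inc) (y : W) : G.IsClique {v | inc v y} :=
  fun _ hv _ hw hne => h.adj_of_inc hne hv hw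

end LocalStar

/-- The members of `S`, each viewed as joining its two points, form a multigraph on the points
that has neither parallel edges nor vertices of degree one. -/
structure IsSimpleLeafless (inc : V → W → Prop) (S : Set V) : Prop where
  through : ∀ {v}, v ∈ S → Through inc v
  exists_ne : ∀ {v y}, v ∈ S → inc v y → ∃ w ∈ S, w ≠ v ∧ inc w y
  eq_of_inc : ∀ {v w y z}, v ∈ S → w ∈ S → y ≠ z → inc v y → inc v z → inc w y → inc w z → v = w

theorem isSimpleLeafless_range_iff {f : U → V} (hf : Function.Injective f) :
    IsSimpleLeafless inc (Set.range f) ↔ IsSimpleLeafless (fun x => inc (f x)) Set.univ := by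
  constructor
  · intro h
    refine ⟨fun {x} _ => h.through ⟨x, rfl⟩, fun {x y} _ hy => ?_,
      fun {v w y z} _ _ hyz h₁ h₂ h₃ h₄ => hf (h.eq_of_inc ⟨v, rfl⟩ ⟨w, rfl⟩ hyz h₁ h₂ h₃ h₄)⟩
    obtain ⟨_, ⟨w, rfl⟩, hne, hwy⟩ := h.exists_ne ⟨x, rfl⟩ hy
    exact ⟨w, trivial, fun h => hne (congrArg f h), hwy⟩
  · intro h
    refine ⟨?_, ?_, ?_⟩
    · rintro _ ⟨x, rfl⟩
      exact h.through (Set.mem_univ x)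
    · rintro _ y ⟨x, rfl⟩ hy
      obtain ⟨w, -, hne, hwy⟩ := h.exists_ne (Set.mem_univ x) hy
      exact ⟨f w, ⟨w, rfl⟩, hf.ne hne, hwy⟩
    · rintro _ _ y z ⟨x, rfl⟩ ⟨w, rfl⟩ hyz h₁ h₂ h₃ h₄
      exact congrArg f (h.eq_of_inc (Set.mem_univ x) (Set.mem_univ w) hyz h₁ h₂ h₃ h₄)

theorem nonempty_of_maximal_isClique [Nonempty V] {C : Set V} (hC : Maximal G.IsClique C) :
    C.Nonempty := by
  obtain ⟨v⟩ := ‹Nonempty V›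
  by_contra hne
  obtain rfl := Set.not_nonempty_iff_eq_empty.1 hne
  exact hC.2 (G.isClique_singleton v) (Set.empty_subset _) rfl

namespace IsSimpleLeafless

theorem eq_of_subset (h : IsSimpleLeafless inc Set.univ) {v : V} {y z : W} (hv : inc v y)
    (hyz : {x | inc x y} ⊆ {x | inc x z}) : y = z := by
  by_contra hne
  obtain ⟨w, -, hwv, hw⟩ := h.exists_ne (Set.mem_univ v) hv
  exact hwv (h.eq_of_inc trivial trivial hne hw (hyz hw) hv (hyz hv))

theorem exists_subset_of_isClique (h : IsSimpleLeafless inc Set.univ) (hL : LocalStar G vis inc)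
    {Q : Set V} (hQ : Q.Nonempty) (hQc : G.IsClique Q) : ∃ y, Q ⊆ {v | inc v y} := by
  obtain ⟨y, hy⟩ := hL.helly Q hQ hQc
  exact ⟨y, fun v hv => hL.inc_of_through (h.through (Set.mem_univ v)) (hy v hv)⟩

theorem maximal_isClique (h : IsSimpleLeafless inc Set.univ) (hL : LocalStar G vis inc)
    {y : W} (hy : y ∈ points inc Set.univ) : Maximal G.IsClique {v | inc v y} := by
  obtain ⟨v, -, hv⟩ := hy
  refine ⟨hL.isClique y, fun Q hQ hyQ => ?_⟩
  obtain ⟨z, hz⟩ := h.exists_subset_of_isClique hL ⟨v, hyQ hv⟩ hQ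
  obtain rfl := h.eq_of_subset hv (hyQ.trans hz)
  exact hz

theorem exists_eq_of_maximal [Nonempty V] (h : IsSimpleLeafless inc Set.univ)
    (hL : LocalStar G vis inc) {C : Set V} (hC : Maximal G.IsClique C) :
    ∃ y ∈ points inc Set.univ, {v | inc v y} = C := by
  have hne := nonempty_of_maximal_isClique hC
  obtain ⟨y, hy⟩ := h.exists_subset_of_isClique hL hne hC.1
  obtain ⟨v, hv⟩ := hne
  exact ⟨y, ⟨v, trivial, hy hv⟩, (hC.eq_of_subset (hL.isClique y) hy).symm⟩

theorem ncard_maximal_isClique [Nonempty V] (h : IsSimpleLeafless inc Set.univ)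
    (hL : LocalStar G vis inc) :
    {C : Set V | Maximal G.IsClique C}.ncard = (points inc Set.univ).ncard := by
  have himg : {C : Set V | Maximal G.IsClique C} =
      (fun y => {v | inc v y}) '' points inc Set.univ := by
    ext C
    constructor
    · exact h.exists_eq_of_maximal hL
    · rintro ⟨y, hy, rfl⟩
      exact h.maximal_isClique hL hy
  rw [himg]
  refine Set.InjOn.ncard_image ?_
  rintro y ⟨v, -, hv⟩ z - hyz
  exact h.eq_of_subset hv hyz.le

end IsSimpleLeafless

/-- A path `b 0, e 0, b 1, e 1, …, b l` of distinct points and of members joining consecutive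
points. -/
structure IsLinkPath (inc : V → W → Prop) {l : ℕ} (b : Fin (l + 1) → W) (e : Fin l → V) :
    Prop where
  injective : Function.Injective b
  left : ∀ i, inc (e i) (b i.castSucc)
  right : ∀ i, inc (e i) (b i.succ)

namespace IsLinkPath

variable {l : ℕ} {b : Fin (l + 1) → W} {e : Fin l → V}

theorem castSucc_ne_succ (h : IsLinkPath inc b e) (i : Fin l) : b i.castSucc ≠ b i.succ :=
  h.injective.ne i.castSucc_lt_succ.ne

theorem start_ne_end (h : IsLinkPath inc b e) (hl : l ≠ 0) : b 0 ≠ b (Fin.last l) :=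
  h.injective.ne fun h => hl (congrArg Fin.val h).symm

theorem through (h : IsLinkPath inc b e) (i : Fin l) : Through inc (e i) :=
  ⟨_, _, h.castSucc_ne_succ i, h.left i, h.right i⟩

theorem eq_or_eq (hL : LocalStar G vis inc) (h : IsLinkPath inc b e) {i : Fin l} {y : W}
    (hy : inc (e i) y) : y = b i.castSucc ∨ y = b i.succ :=
  hL.eq_or_eq (h.left i) (h.right i) (h.castSucc_ne_succ i) (hL.vis_of_inc hy)

theorem eq_of_inc (hL : LocalStar G vis inc) (h : IsLinkPath inc b e) {i j : Fin l} {y z : W}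
    (hyz : y ≠ z) (hiy : inc (e i) y) (hiz : inc (e i) z) (hjy : inc (e j) y)
    (hjz : inc (e j) z) : i = j := by
  have hi := h.eq_or_eq hL hiy
  have hi' := h.eq_or_eq hL hiz
  have hj := h.eq_or_eq hL hjy
  have hj' := h.eq_or_eq hL hjz
  have hinj := @h.injective
  have h₁ := @hinj i.castSucc j.castSucc
  have h₂ := @hinj i.castSucc j.succ
  have h₃ := @hinj i.succ j.castSucc
  have h₄ := @hinj i.succ j.succ
  simp only [Fin.ext_iff, Fin.val_castSucc, Fin.val_succ] at h₁ h₂ h₃ h₄ ⊢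
  grind

theorem edge_injective (hL : LocalStar G vis inc) (h : IsLinkPath inc b e) :
    Function.Injective e := fun i _ hij =>
  h.eq_of_inc hL (h.castSucc_ne_succ i) (h.left i) (h.right i) (hij ▸ h.left i) (hij ▸ h.right i)

end IsLinkPath

/-- A path with at least two edges which has exactly its two ends in `K`. -/
structure IsEar (inc : V → W → Prop) (K : Set W) {l : ℕ} (b : Fin (l + 1) → W) (e : Fin l → V) :
    Prop extends IsLinkPath inc b e where
  two_le : 2 ≤ l
  start_mem : b 0 ∈ K
  end_mem : b (Fin.last l) ∈ K
  notMem : ∀ i, i ≠ 0 → i ≠ Fin.last l → b i ∉ K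

namespace IsEar

variable {l : ℕ} {b : Fin (l + 1) → W} {e : Fin l → V} {K : Set W} {S : Set V}

theorem exists_notMem (h : IsEar inc K b e) (i : Fin l) : ∃ y, inc (e i) y ∧ y ∉ K := by
  have hl := h.two_le
  by_cases hi : i.val = 0
  · refine ⟨_, h.right i, h.notMem _ (Fin.succ_ne_zero i) ?_⟩
    simp only [ne_eq, Fin.ext_iff, Fin.val_succ, Fin.val_last]
    omega
  · refine ⟨_, h.left i, h.notMem _ (fun h => hi (congrArg Fin.val h)) i.castSucc_lt_last.ne⟩

theorem edge_notMem (h : IsEar inc (points inc S) b e) (i : Fin l) : e i ∉ S := by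
  intro hS
  obtain ⟨y, hy, hyK⟩ := h.exists_notMem i
  exact hyK ⟨_, hS, hy⟩

theorem exists_inc_start (h : IsEar inc K b e) : ∃ i, inc (e i) (b 0) :=
  ⟨⟨0, by have := h.two_le; omega⟩, h.left _⟩

theorem exists_inc_end (h : IsEar inc K b e) : ∃ i, inc (e i) (b (Fin.last l)) := by
  obtain ⟨n, rfl⟩ : ∃ n, l = n + 1 := ⟨l - 1, by have := h.two_le; omega⟩
  exact ⟨Fin.last n, h.right _⟩

theorem exists_ne_of_inc (hL : LocalStar G vis inc) (h : IsEar inc (points inc S) b e) {i : Fin l}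
    {y : W} (hy : inc (e i) y) : ∃ w ∈ S ∪ Set.range e, w ≠ e i ∧ inc w y := by
  have hold {y} (hy : y ∈ points inc S) : ∃ w ∈ S ∪ Set.range e, w ≠ e i ∧ inc w y := by
    obtain ⟨w, hw, hwy⟩ := hy
    exact ⟨w, Or.inl hw, fun hwi => h.edge_notMem i (hwi ▸ hw), hwy⟩
  have hnew {j} (hj : j ≠ i) (hjy : inc (e j) y) : ∃ w ∈ S ∪ Set.range e, w ≠ e i ∧ inc w y :=
    ⟨e j, Or.inr ⟨j, rfl⟩, (h.edge_injective hL).ne hj, hjy⟩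
  obtain ⟨n, rfl⟩ : ∃ n, l = n + 1 := ⟨l - 1, by have := h.two_le; omega⟩
  rcases h.eq_or_eq hL hy with rfl | rfl
  · cases i using Fin.cases with
    | zero => exact hold h.start_mem
    | succ i => exact hnew i.castSucc_lt_succ.ne (h.right i.castSucc)
  · cases i using Fin.lastCases with
    | last => exact hold h.end_mem
    | cast i => exact hnew i.castSucc_lt_succ.ne' (h.left i.succ)

theorem not_inc_of_mem (hL : LocalStar G vis inc) (h : IsEar inc (points inc S) b e) {v : V}
    (hv : v ∈ S) {i : Fin l} {y z : W} (hyz : y ≠ z) (hvy : inc v y) (hvz : inc v z)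
    (hiy : inc (e i) y) : ¬ inc (e i) z := by
  intro hiz
  obtain ⟨x, hx, hxS⟩ := h.exists_notMem i
  rcases hL.eq_or_eq hiy hiz hyz (hL.vis_of_inc hx) with rfl | rfl
  · exact hxS ⟨v, hv, hvy⟩
  · exact hxS ⟨v, hv, hvz⟩

theorem isSimpleLeafless_union (hL : LocalStar G vis inc) (h : IsEar inc (points inc S) b e)
    (through : ∀ v ∈ S, Through inc v)
    (exists_ne : ∀ v ∈ S, ∀ y, inc v y →
      (∃ w ∈ S, w ≠ v ∧ inc w y) ∨ y = b 0 ∨ y = b (Fin.last l))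
    (eq_of_inc : ∀ v ∈ S, ∀ w ∈ S, ∀ y z, y ≠ z → inc v y → inc v z → inc w y → inc w z → v = w) :
    IsSimpleLeafless inc (S ∪ Set.range e) where
  through := by
    rintro v (hv | ⟨i, rfl⟩)
    exacts [through v hv, h.through i]
  exists_ne := by
    rintro v y (hv | ⟨i, rfl⟩) hy
    · have hnew (hex : ∃ i, inc (e i) y) : ∃ w ∈ S ∪ Set.range e, w ≠ v ∧ inc w y := by
        obtain ⟨i, hi⟩ := hex
        exact ⟨e i, Or.inr ⟨i, rfl⟩, fun hiv => h.edge_notMem i (hiv ▸ hv), hi⟩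
      rcases exists_ne v hv y hy with ⟨w, hw, hne, hwy⟩ | rfl | rfl
      exacts [⟨w, Or.inl hw, hne, hwy⟩, hnew h.exists_inc_start, hnew h.exists_inc_end]
    · exact h.exists_ne_of_inc hL hy
  eq_of_inc := by
    rintro v w y z (hv | ⟨i, rfl⟩) (hw | ⟨j, rfl⟩) hyz hvy hvz hwy hwz
    · exact eq_of_inc v hv w hw y z hyz hvy hvz hwy hwz
    · exact (h.not_inc_of_mem hL hv hyz hvy hvz hwy hwz).elim
    · exact (h.not_inc_of_mem hL hw hyz hwy hwz hvy hvz).elim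
    · exact congrArg e (h.toIsLinkPath.eq_of_inc hL hyz hvy hvz hwy hwz)

end IsEar

theorem IsSimpleLeafless.union_ear (hL : LocalStar G vis inc) {l : ℕ} {b : Fin (l + 1) → W}
    {e : Fin l → V} {S : Set V} (hS : IsSimpleLeafless inc S)
    (hE : IsEar inc (points inc S) b e) : IsSimpleLeafless inc (S ∪ Set.range e) :=
  hE.isSimpleLeafless_union hL (fun _ hv => hS.through hv)
    (fun _ hv _ hy => Or.inl (hS.exists_ne hv hy))
    (fun _ hv _ hw _ _ hyz h₁ h₂ h₃ h₄ => hS.eq_of_inc hv hw hyz h₁ h₂ h₃ h₄)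

theorem IsLinkPath.isEar_points_singleton (hL : LocalStar G vis inc) {l : ℕ} {b : Fin (l + 1) → W}
    {e : Fin l → V} (h : IsLinkPath inc b e) (hl : 2 ≤ l) {v : V} (h₀ : inc v (b 0))
    (h₁ : inc v (b (Fin.last l))) : IsEar inc (points inc {v}) b e where
  toIsLinkPath := h
  two_le := hl
  start_mem := ⟨v, rfl, h₀⟩
  end_mem := ⟨v, rfl, h₁⟩
  notMem := by
    rintro i hi₀ hi₁ ⟨_, rfl, hi⟩
    rcases hL.eq_or_eq h₀ h₁ (h.start_ne_end (by omega)) (hL.vis_of_inc hi) with hb | hb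
    exacts [hi₀ (h.injective hb), hi₁ (h.injective hb)]

theorem mem_points_singleton {v : V} {y : W} : y ∈ points inc {v} ↔ inc v y := by
  simp only [points, Set.mem_singleton_iff, exists_eq_left, Set.mem_ofPred_eq]

theorem IsEar.isSimpleLeafless_insert (hL : LocalStar G vis inc) {l : ℕ} {b : Fin (l + 1) → W}
    {e : Fin l → V} {v : V} (hE : IsEar inc (points inc {v}) b e) :
    IsSimpleLeafless inc (insert v (Set.range e)) := by
  have hne : b 0 ≠ b (Fin.last l) :=
    hE.start_ne_end (by have := hE.two_le; omega)
  have h₀ := mem_points_singleton.1 hE.start_mem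
  have h₁ := mem_points_singleton.1 hE.end_mem
  rw [← Set.singleton_union]
  refine hE.isSimpleLeafless_union hL ?_ ?_ ?_
  · rintro _ rfl
    exact ⟨_, _, hne, h₀, h₁⟩
  · rintro _ rfl y hy
    exact Or.inr (hL.eq_or_eq h₀ h₁ hne (hL.vis_of_inc hy))
  · rintro _ rfl _ rfl - - - - - - -
    rfl

end LocalStar

section Turns

variable {W : Type v} {T : SimpleGraph W}

theorem branch_getVert_of_lt (hT : T.IsTree) {s t : W} {p : T.Walk s t} (hp : p.IsPath) {j m : ℕ}
    (hjm : j < m) (hm : m ≤ p.length) :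
    branch hT (p.getVert m) (p.getVert j) = p.getVert (m - 1) := by
  have hr : (p.take m).reverse.IsPath := (hp.take m).reverse
  rw [branch_eq_of_mem_support hT hr, branch_eq_snd hT hr, Walk.snd_reverse, Walk.penultimate,
    Walk.take_getVert, Walk.take_length, min_eq_left hm, min_eq_right (Nat.sub_le m 1)]
  · rw [Walk.support_reverse, List.mem_reverse, ← min_eq_right hjm.le, ← Walk.take_getVert]
    exact Walk.getVert_mem_support _ _
  · exact fun h => hjm.ne (hp.getVert_injOn (hjm.le.trans hm) hm h)

theorem exists_turn_of_lt (hT : T.IsTree) {s t : W} {p : T.Walk s t} (hp : p.IsPath)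
    {X : Set (Sym2 W)} {j k : ℕ} (hjk : j < k) (hk : k < p.edges.length) (hjX : p.edges[j] ∉ X)
    (hkX : p.edges[k] ∈ X) :
    ∃ q y z u, s(q, y) ∈ between T s t ∧ s(q, y) ∈ X ∧ s(q, z) ∈ between T s t ∧ s(q, z) ∉ X ∧
      u ∈ p.edges[j] ∧ u ≠ q ∧ branch hT q u = z := by
  obtain ⟨i, hi, hi', hiX⟩ := Nat.exists_not_and_succ_of_not_zero_of_exists
    (p := fun i => ∃ h : j + i < p.edges.length, p.edges[j + i] ∈ X) (fun ⟨_, h⟩ => hjX h)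
    ⟨k - j, by omega, by simpa only [Nat.add_sub_cancel' hjk.le] using hkX⟩
  have hiX' : p.edges[j + i] ∉ X := fun h => hi ⟨by omega, h⟩
  have mem (n) (hn : n < p.edges.length) : p.edges[n] ∈ between T s t := by
    rw [← edgeSet_eq_between hT hp]
    exact List.getElem_mem hn
  have hy := mem _ hi'
  have hz := mem (j + i) (by omega)
  simp only [Walk.getElem_edges] at hiX hiX' hy hz ⊢
  rw [Sym2.eq_swap] at hiX' hz
  rw [Walk.length_edges] at hi'
  exact ⟨_, _, _, p.getVert j, hy, hiX, hz, hiX', Sym2.mem_mk_left _ _,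
    fun h => absurd (hp.getVert_injOn (by grind) (by grind) h) (by omega),
    branch_getVert_of_lt hT hp (by omega) (by omega)⟩

theorem exists_turn (hT : T.IsTree) {s t : W} {X : Set (Sym2 W)} {f g : Sym2 W}
    (hf : f ∈ between T s t) (hfX : f ∈ X) (hg : g ∈ between T s t) (hgX : g ∉ X) :
    ∃ q y z u, s(q, y) ∈ between T s t ∧ s(q, y) ∈ X ∧ s(q, z) ∈ between T s t ∧ s(q, z) ∉ X ∧
      u ∈ g ∧ u ≠ q ∧ branch hT q u = z := by
  obtain ⟨p, hp⟩ := hT.connected.exists_isPath s t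
  rw [← edgeSet_eq_between hT hp, Walk.mem_edgeSet] at hf hg
  obtain ⟨j, hj, rfl⟩ := List.getElem_of_mem hg
  obtain ⟨k, hk, rfl⟩ := List.getElem_of_mem hf
  have hne : j ≠ k := by rintro rfl; exact hgX hfX
  rcases hne.lt_or_gt with hjk | hkj
  · exact exists_turn_of_lt hT hp hjk hk hgX hfX
  · have hr (i) (hi : i < p.edges.length) : ∃ h : p.edges.length - 1 - i < p.reverse.edges.length,
        p.edges[i] = p.reverse.edges[p.edges.length - 1 - i] := by
      simp only [Walk.edges_reverse, List.length_reverse, List.getElem_reverse]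
      exact ⟨by omega, getElem_congr_idx (by omega)⟩
    obtain ⟨hj', hjr⟩ := hr j hj
    obtain ⟨hk', hkr⟩ := hr k hk
    rw [hjr] at hgX ⊢
    rw [hkr] at hfX
    rw [between_comm]
    exact exists_turn_of_lt hT hp.reverse (by omega) hk' hgX hfX

end Turns

section HellyRep

variable {V : Type u} {U : Type*} {W : Type v} {G : SimpleGraph V} {T : SimpleGraph W}
  {s t : V → W}

/-- The paths of the tree `T` between `s x` and `t x` form a Helly EPT representation of `G`. -/
structure HellyRep (G : SimpleGraph V) (T : SimpleGraph W) (s t : V → W) : Prop where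
  adj_iff : ∀ x y : V, x ≠ y →
    (G.Adj x y ↔ (between T (s x) (t x) ∩ between T (s y) (t y)).Nonempty)
  helly : HellyProperty fun x : V => between T (s x) (t x)

theorem hellyRep_of_isHelly (hT : T.IsTree) (R : EPTRepresentation G T) (hR : R.IsHelly) :
    HellyRep G T R.src R.tgt := by
  have hpath (x) := edgeSet_eq_between hT (R.path x).2
  constructor
  · simpa only [← hpath] using R.adj_iff
  · simpa only [EPTRepresentation.IsHelly, hpath] using hR

namespace HellyRep

theorem exists_isHelly (hT : T.IsTree) (h : HellyRep G T s t) :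
    ∃ R : EPTRepresentation G T, R.IsHelly := by
  choose p hp using fun x => hT.connected.exists_isPath (s x) (t x)
  have hpath (x) := edgeSet_eq_between hT (hp x)
  refine ⟨⟨s, t, fun x => ⟨p x, hp x⟩, ?_⟩, ?_⟩
  · simpa only [hpath] using h.adj_iff
  · simpa only [EPTRepresentation.IsHelly, hpath] using h.helly

theorem comp {H : SimpleGraph U} (h : HellyRep G T s t) (f : H ↪g G) :
    HellyRep H T (s ∘ f) (t ∘ f) where
  adj_iff x y hxy := by
    rw [← f.map_adj_iff]
    exact h.adj_iff _ _ (f.injective.ne hxy)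
  helly I hI hp := by
    obtain ⟨g, hg⟩ := h.helly (f '' I) (hI.image f) <| by
      rintro _ ⟨x, hx, rfl⟩ _ ⟨y, hy, rfl⟩ hne
      exact hp hx hy fun h => hne (congrArg f h)
    rw [Set.biInter_image] at hg
    exact ⟨g, hg⟩

theorem exists_forall_mem (h : HellyRep G T s t) {Q : Set V} (hQ : Q.Nonempty)
    (hQc : G.IsClique Q) : ∃ g, ∀ v ∈ Q, g ∈ between T (s v) (t v) := by
  obtain ⟨g, hg⟩ := h.helly Q hQ fun v hv w hw hne => (h.adj_iff v w hne).1 (hQc hv hw hne)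
  exact ⟨g, by simpa only [Set.mem_iInter] using hg⟩

end HellyRep

/-- The path of `v` uses the edge from `q` to `y`. -/
def Uses (T : SimpleGraph W) (s t : V → W) (q : W) (v : V) (y : W) : Prop :=
  s(q, y) ∈ between T (s v) (t v)

/-- The path of `v` uses an edge that lies in the direction of `y` from `q`. -/
def Visits (hT : T.IsTree) (s t : V → W) (q : W) (v : V) (y : W) : Prop :=
  ∃ g ∈ between T (s v) (t v), ∃ u ∈ g, u ≠ q ∧ branch hT q u = y

theorem Uses.visits (hT : T.IsTree) {q y : W} {v : V} (h : Uses T s t q v y) :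
    Visits hT s t q v y :=
  ⟨_, h, y, Sym2.mem_mk_right q y, (show T.Adj q y from h.1).ne', branch_of_adj hT h.1⟩

theorem Visits.adj {hT : T.IsTree} {q y : W} {v : V} (h : Visits hT s t q v y) : T.Adj q y := by
  obtain ⟨-, -, u, -, huq, rfl⟩ := h
  exact adj_branch hT huq

theorem Visits.eq_branch_or {hT : T.IsTree} {q y : W} {v : V} (h : Visits hT s t q v y) :
    branch hT q (s v) = y ∨ branch hT q (t v) = y := by
  obtain ⟨g, hg, u, hu, huq, rfl⟩ := h
  exact branch_eq_or_of_mem_between hT hg hu huq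

theorem Visits.uses {hT : T.IsTree} {q y z : W} {v : V} (hy : Visits hT s t q v y)
    (hz : Visits hT s t q v z) (hyz : y ≠ z) : Uses T s t q v y := by
  rw [Uses, mk_mem_between_iff hT hy.adj]
  have := hy.eq_branch_or
  have := hz.eq_branch_or
  grind

theorem HellyRep.localStar (hT : T.IsTree) (h : HellyRep G T s t) (q : W) :
    LocalStar G (Visits hT s t q) (Uses T s t q) where
  vis_of_inc h := h.visits hT
  inc_of_vis := Visits.uses
  eq_or_eq hx hy hne hz := by
    have := (hx.visits hT).eq_branch_or
    have := (hy.visits hT).eq_branch_or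
    have := hz.eq_branch_or
    grind
  adj_of_inc hvw hv hw := (h.adj_iff _ _ hvw).2 ⟨_, hv, hw⟩
  helly Q hQ hQc := by
    obtain ⟨g, hg⟩ := h.exists_forall_mem hQ hQc
    obtain ⟨v, hv⟩ := hQ
    obtain ⟨u, hu, huq⟩ := exists_mem_ne_of_mem_edgeSet (hg v hv).1 q
    exact ⟨branch hT q u, fun w hw => ⟨g, hg w hw, u, hu, huq, rfl⟩⟩

end HellyRep

section LinkPaths

variable {V : Type u} {W : Type v} {G : SimpleGraph V} {vis inc : V → W → Prop}

theorem eq_last_or_exists_succ_ne {l : ℕ} (b : Fin (l + 1) → W) (i : Fin (l + 1)) :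
    b (Fin.last l) = b i ∨
      ∃ k : Fin l, i ≤ k.castSucc ∧ b k.castSucc = b i ∧ b k.succ ≠ b k.castSucc := by
  by_contra! hc
  obtain ⟨hlast, hstep⟩ := hc
  have hconst (k : Fin (l + 1)) : i ≤ k → b k = b i := by
    induction k using Fin.induction with
    | zero => exact fun h => congrArg b (le_antisymm (Fin.zero_le i) h)
    | succ k ih =>
      intro hk
      rcases hk.eq_or_lt with rfl | hk
      · rfl
      · have hk' : i ≤ k.castSucc := Fin.le_castSucc_iff.2 hk
        exact (hstep k hk' (ih hk')).trans (ih hk')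
  exact hlast (hconst _ (Fin.le_last i))

theorem eq_zero_or_exists_castSucc_ne {l : ℕ} (b : Fin (l + 1) → W) (i : Fin (l + 1)) :
    b 0 = b i ∨ ∃ k : Fin l, k.succ ≤ i ∧ b k.succ = b i ∧ b k.castSucc ≠ b k.succ := by
  rcases eq_last_or_exists_succ_ne (b ∘ Fin.rev) i.rev with h | ⟨k, hk, hki, hne⟩
  · exact Or.inl (by simpa using h)
  · refine Or.inr ⟨k.rev, ?_, by simpa [Fin.rev_castSucc] using hki,
      by simpa [Fin.rev_castSucc, Fin.rev_succ] using hne⟩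
    simpa [Fin.rev_castSucc] using Fin.rev_le_rev.2 hk

/-- A constant stretch of `b` would be entered and left by two members of distance at least `2`. -/
theorem castSucc_ne_succ_of_inc {l : ℕ} {inc : Fin l → W → Prop} {b : Fin (l + 1) → W}
    (hne : b 0 ≠ b (Fin.last l)) (left : ∀ i, b i.castSucc ≠ b i.succ → inc i (b i.castSucc))
    (right : ∀ i, b i.castSucc ≠ b i.succ → inc i (b i.succ))
    (start : ∀ i, inc i (b 0) → i.val = 0) (finish : ∀ i, inc i (b (Fin.last l)) → i.val + 1 = l)
    (far : ∀ i j y, inc i y → inc j y → j.val ≤ i.val + 1) (i : Fin l) :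
    b i.castSucc ≠ b i.succ := by
  intro hi
  rcases eq_zero_or_exists_castSucc_ne b i.castSucc with h₀ | ⟨k, hki, hk, hkne⟩ <;>
    rcases eq_last_or_exists_succ_ne b i.succ with h₁ | ⟨m, him, hm, hmne⟩
  · exact hne (h₀.trans (hi.trans h₁.symm))
  · have := start m (by simpa only [hm, h₀, hi] using left m hmne.symm)
    simp only [Fin.le_def, Fin.val_succ, Fin.val_castSucc] at him
    omega
  · have := finish k (by simpa only [hk, h₁, hi] using right k hkne)
    simp only [Fin.le_def, Fin.val_succ, Fin.val_castSucc] at hki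
    omega
  · have := far k m (b i.succ) (by simpa only [hk, hi] using right k hkne)
      (by simpa only [hm] using left m hmne.symm)
    simp only [Fin.le_def, Fin.val_succ, Fin.val_castSucc] at hki him
    omega

namespace LocalStar

theorem isLinkPath_of_vis (hL : LocalStar G vis inc) {l : ℕ} {b : Fin (l + 1) → W}
    {e : Fin l → V} (hne : b 0 ≠ b (Fin.last l)) (left : ∀ i, vis (e i) (b i.castSucc))
    (right : ∀ i, vis (e i) (b i.succ)) (start : ∀ i, inc (e i) (b 0) → i.val = 0)
    (finish : ∀ i, inc (e i) (b (Fin.last l)) → i.val + 1 = l)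
    (far : ∀ i j y, inc (e i) y → inc (e j) y → j.val ≤ i.val + 1) : IsLinkPath inc b e := by
  have step := castSucc_ne_succ_of_inc (inc := fun i => inc (e i)) hne
    (fun i h => hL.inc_of_vis (left i) (right i) h)
    (fun i h => hL.inc_of_vis (right i) (left i) h.symm) start finish far
  have inc_left (i) : inc (e i) (b i.castSucc) := hL.inc_of_vis (left i) (right i) (step i)
  have hlt {i j : Fin (l + 1)} (hij : i < j) : b i ≠ b j := by
    intro heq
    obtain ⟨i, rfl⟩ := Fin.exists_castSucc_eq.2 (hij.trans_le (Fin.le_last j)).ne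
    have hi := inc_left i
    have hji : j.val = i.val + 1 := by
      have := Fin.lt_def.1 hij
      cases j using Fin.lastCases with
      | last => exact (finish i (heq ▸ hi)).symm
      | cast j =>
        have := far i j _ hi (heq ▸ inc_left j)
        simp only [Fin.val_castSucc] at *
        omega
    obtain rfl : j = i.succ := Fin.ext hji
    exact step i heq
  exact ⟨Function.Injective.of_lt_imp_ne fun _ _ => hlt, inc_left,
    fun i => hL.inc_of_vis (right i) (left i) (step i).symm⟩

theorem exists_vis_chain (hL : LocalStar G vis inc) {n : ℕ} (f : pathGraph (n + 1) →g G)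
    {y₀ y₁ : W} (h₀ : vis (f 0) y₀) (h₁ : vis (f (Fin.last n)) y₁) :
    ∃ b : Fin (n + 2) → W, b 0 = y₀ ∧ b (Fin.last (n + 1)) = y₁ ∧
      (∀ i : Fin (n + 1), vis (f i) (b i.castSucc)) ∧ ∀ i : Fin (n + 1), vis (f i) (b i.succ) := by
  have hadj (i : Fin n) : G.Adj (f i.castSucc) (f i.succ) :=
    f.map_adj (pathGraph_adj.2 (Or.inl rfl))
  choose w hw hw' using fun i => hL.exists_vis_of_adj (hadj i)
  refine ⟨Fin.cons y₀ (Fin.snoc w y₁ : Fin (n + 1) → W), rfl, ?_, fun i => ?_, fun i => ?_⟩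
  · rw [← Fin.succ_last, Fin.cons_succ, Fin.snoc_last]
  · cases i using Fin.cases with
    | zero => exact h₀
    | succ i => simpa only [← Fin.succ_castSucc, Fin.cons_succ, Fin.snoc_castSucc] using hw' i
  · rw [Fin.cons_succ]
    cases i using Fin.lastCases with
    | last => simpa only [Fin.snoc_last] using h₁
    | cast i => simpa only [Fin.snoc_castSucc] using hw i

theorem exists_isLinkPath (hL : LocalStar G vis inc) {n : ℕ} (f : pathGraph (n + 1) ↪g G)
    {y₀ y₁ : W} (hne : y₀ ≠ y₁) (h₀ : vis (f 0) y₀) (h₁ : vis (f (Fin.last n)) y₁)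
    (start : ∀ i, inc (f i) y₀ → i = 0) (finish : ∀ i, inc (f i) y₁ → i = Fin.last n) :
    ∃ b : Fin (n + 2) → W, b 0 = y₀ ∧ b (Fin.last (n + 1)) = y₁ ∧ IsLinkPath inc b f := by
  obtain ⟨b, rfl, rfl, left, right⟩ := hL.exists_vis_chain f.toHom h₀ h₁
  refine ⟨b, rfl, rfl, hL.isLinkPath_of_vis hne left right (fun i hi => ?_) (fun i hi => ?_)
    fun i j y hi hj => ?_⟩
  · exact congrArg Fin.val (start i hi)
  · exact congrArg (Fin.val · + 1) (finish i hi)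
  · by_contra! hij
    have hne : i ≠ j := Fin.ne_of_val_ne (by omega)
    have hadj := f.map_adj_iff.1 (hL.adj_of_inc (f.injective.ne hne) hi hj)
    rw [pathGraph_adj] at hadj
    omega

end LocalStar

end LinkPaths

section Gates

theorem cycleGraph_adj_iff_of_lt {n : ℕ} (hn : 3 ≤ n) {i j : Fin n} (hij : i < j) :
    (cycleGraph n).Adj i j ↔ j.val = i.val + 1 ∨ (i.val = 0 ∧ j.val + 1 = n) := by
  have := Fin.lt_def.1 hij
  have hi : ((i - j : Fin n) : ℕ) = n - j.val + i.val := by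
    rw [Fin.sub_def]
    exact Nat.mod_eq_of_lt (by omega)
  have hj : ((j - i : Fin n) : ℕ) = j.val - i.val := Fin.coe_sub_iff_le.2 hij.le
  rw [cycleGraph_adj', hi, hj]
  omega

/-- The cycle without its last vertex is a chordless path. -/
def pathGraphEmbeddingCycleGraph {n : ℕ} (hn : 1 ≤ n) :
    pathGraph (n + 1) ↪g cycleGraph (n + 2) where
  toFun := Fin.castSucc
  inj' := Fin.castSucc_injective _
  map_rel_iff' {i j} := by
    change (cycleGraph (n + 2)).Adj i.castSucc j.castSucc ↔ _
    rw [pathGraph_adj]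
    rcases lt_trichotomy i j with h | rfl | h
    · rw [cycleGraph_adj_iff_of_lt (by omega) (Fin.castSucc_lt_castSucc_iff.2 h)]
      simp only [Fin.lt_def, Fin.val_castSucc] at *
      omega
    · simp
    · rw [adj_comm, cycleGraph_adj_iff_of_lt (by omega) (Fin.castSucc_lt_castSucc_iff.2 h)]
      simp only [Fin.lt_def, Fin.val_castSucc] at *
      omega

theorem cycleGraph_adj_castSucc_last_iff {n : ℕ} (hn : 1 ≤ n) {i : Fin (n + 1)} :
    (cycleGraph (n + 2)).Adj i.castSucc (Fin.last (n + 1)) ↔ i = 0 ∨ i = Fin.last n := by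
  rw [cycleGraph_adj_iff_of_lt (by omega) i.castSucc_lt_last]
  simp only [Fin.val_last, Fin.val_castSucc, Fin.ext_iff, Fin.val_zero, and_true]
  omega

section AttachPath

variable {U : Type u} {H : SimpleGraph U} {C C' : Set U} {l : ℕ}

theorem attachPath_adj_inl_inr {x : U} {i : Fin l} :
    (attachPath H C C' l).Adj (Sum.inl x) (Sum.inr i) ↔
      (i.val = 0 ∧ x ∈ C) ∨ (i.val + 1 = l ∧ x ∈ C') := by
  simp [attachPath]

/-- The old part of an extended graph. -/
def embeddingAttachPath (H : SimpleGraph U) (C C' : Set U) (l : ℕ) : H ↪g attachPath H C C' l where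
  toFun := Sum.inl
  inj' := Sum.inl_injective
  map_rel_iff' := by simp [attachPath]

/-- The attached path of an extended graph. -/
def pathGraphEmbeddingAttachPath (H : SimpleGraph U) (C C' : Set U) (l : ℕ) :
    pathGraph l ↪g attachPath H C C' l where
  toFun := Sum.inr
  inj' := Sum.inr_injective
  map_rel_iff' := by simp [attachPath]

end AttachPath

variable {U : Type u} {V : Type u} {W : Type v}

theorem IsSimpleLeafless.vis_of_forall_adj {G : SimpleGraph V} {vis inc : V → W → Prop}
    (hL : LocalStar G vis inc) {f : U → V} (h : IsSimpleLeafless (fun x => inc (f x)) Set.univ)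
    {x : U} {y : W} (hx : inc (f x) y) {w : V} (hw : ∀ x, inc (f x) y → G.Adj (f x) w) :
    vis w y := by
  obtain ⟨z, hz⟩ := hL.helly (insert w (f '' {x | inc (f x) y})) (Set.insert_nonempty _ _) <| by
    refine isClique_insert.2 ⟨?_, ?_⟩
    · rintro _ ⟨a, ha, rfl⟩ _ ⟨b, hb, rfl⟩ hne
      exact hL.adj_of_inc hne ha hb
    · rintro _ ⟨a, ha, rfl⟩ -
      exact (hw a ha).symm
  obtain rfl : y = z := h.eq_of_subset hx fun a ha =>
    hL.inc_of_through (h.through (Set.mem_univ a)) (hz _ (Or.inr ⟨a, ha, rfl⟩))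
  exact hz w (Set.mem_insert _ _)

theorem LocalStar.isSimpleLeafless_cycleGraph {n : ℕ} (hn : 2 ≤ n)
    {vis inc : Fin (n + 2) → W → Prop} (hL : LocalStar (cycleGraph (n + 2)) vis inc) {y z : W}
    (hy : inc (Fin.last (n + 1)) y) (hz : inc (Fin.last (n + 1)) z) (h₀y : inc 0 y)
    (h₀z : ¬ inc 0 z) (hnz : vis (Fin.last n).castSucc z) : IsSimpleLeafless inc Set.univ := by
  have hyz : y ≠ z := fun h => h₀z (h ▸ h₀y)
  have hn' : 1 ≤ n := by omega
  have eq_or {i : Fin (n + 1)} {x : W} (hi : inc i.castSucc x) (hx : inc (Fin.last (n + 1)) x) :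
      i = 0 ∨ i = Fin.last n :=
    (cycleGraph_adj_castSucc_last_iff hn').1 (hL.adj_of_inc i.castSucc_lt_last.ne hi hx)
  let path := pathGraphEmbeddingCycleGraph hn'
  obtain ⟨b, rfl, rfl, hb⟩ := hL.exists_isLinkPath path hyz
    (hL.vis_of_inc h₀y) hnz
    (fun i hi => (eq_or hi hy).resolve_right <| by
      rintro rfl
      have hne : (0 : Fin (n + 1)) ≠ Fin.last n := Fin.ne_of_val_ne (by
        rw [Fin.val_zero, Fin.val_last]
        omega)
      have hadj := path.map_adj_iff.1 (hL.adj_of_inc (path.injective.ne hne) h₀y hi)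
      rw [pathGraph_adj, Fin.val_zero, Fin.val_last] at hadj
      omega)
    (fun i hi => (eq_or hi hz).resolve_left (by rintro rfl; exact h₀z hi))
  have hE := hb.isEar_points_singleton hL (by omega) hy hz
  convert hE.isSimpleLeafless_insert hL
  rw [eq_comm, Set.eq_univ_iff_forall]
  intro i
  cases i using Fin.lastCases with
  | last => exact Set.mem_insert _ _
  | cast i => exact Set.mem_insert_of_mem _ ⟨i, rfl⟩

theorem LocalStar.isEar_attachPath {H : SimpleGraph U} {C C' : Set U} {n : ℕ} (hn : 1 ≤ n)
    (hdisj : Disjoint C C') {vis inc : U ⊕ Fin (n + 1) → W → Prop}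
    (hL : LocalStar (attachPath H C C' (n + 1)) vis inc) {b : Fin (n + 2) → W}
    (hb : IsLinkPath inc b Sum.inr) {x x' : U} (hx : inc (Sum.inl x) (b 0))
    (hx' : inc (Sum.inl x') (b (Fin.last (n + 1)))) :
    IsEar inc (points inc (Set.range Sum.inl)) b Sum.inr where
  toIsLinkPath := hb
  two_le := by omega
  start_mem := ⟨_, ⟨x, rfl⟩, hx⟩
  end_mem := ⟨_, ⟨x', rfl⟩, hx'⟩
  notMem := by
    rintro i hi₀ hi₁ ⟨_, ⟨a, rfl⟩, ha⟩
    obtain ⟨i, rfl⟩ := Fin.exists_castSucc_eq.2 hi₁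
    obtain ⟨i, rfl⟩ := Fin.exists_succ_eq.2 fun h : i = 0 => hi₀ (h ▸ rfl)
    have hleft := attachPath_adj_inl_inr.1 (hL.adj_of_inc Sum.inl_ne_inr ha (hb.left i.succ))
    have hright := attachPath_adj_inl_inr.1
      (hL.adj_of_inc Sum.inl_ne_inr ha (hb.right i.castSucc))
    simp only [Fin.val_succ, Fin.val_castSucc] at hleft hright
    exact Set.disjoint_left.1 hdisj (hright.resolve_right (by omega)).2
      (hleft.resolve_left (by omega)).2

theorem LocalStar.isSimpleLeafless_attachPath [Nonempty U] {H : SimpleGraph U} {C C' : Set U}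
    {l : ℕ} (hl : 2 ≤ l) (hC : Maximal H.IsClique C) (hC' : Maximal H.IsClique C')
    (hdisj : Disjoint C C') {vis inc : U ⊕ Fin l → W → Prop}
    (hL : LocalStar (attachPath H C C' l) vis inc)
    (hH : IsSimpleLeafless (fun x => inc (Sum.inl x)) Set.univ) :
    IsSimpleLeafless inc Set.univ := by
  obtain ⟨n, rfl⟩ : ∃ n, l = n + 1 := ⟨l - 1, by omega⟩
  have hLH := hL.comap (embeddingAttachPath H C C' (n + 1))
  obtain ⟨y, ⟨x, -, hx⟩, rfl⟩ := hH.exists_eq_of_maximal hLH hC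
  obtain ⟨y', ⟨x', -, hx'⟩, rfl⟩ := hH.exists_eq_of_maximal hLH hC'
  have not_both {a} (h : inc (Sum.inl a) y) : ¬ inc (Sum.inl a) y' :=
    fun h' => Set.disjoint_left.1 hdisj h h'
  have adj {a i} {w : W} (ha : inc (Sum.inl a) w) (hi : inc (Sum.inr i) w) :=
    attachPath_adj_inl_inr.1 (hL.adj_of_inc Sum.inl_ne_inr ha hi)
  obtain ⟨b, rfl, rfl, hb⟩ := hL.exists_isLinkPath (y₀ := y) (y₁ := y')
    (pathGraphEmbeddingAttachPath H _ _ (n + 1)) (by rintro rfl; exact not_both hx hx)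
    (hH.vis_of_forall_adj hL hx fun a ha => attachPath_adj_inl_inr.2 (Or.inl ⟨rfl, ha⟩))
    (hH.vis_of_forall_adj hL hx' fun a ha => attachPath_adj_inl_inr.2 (Or.inr ⟨rfl, ha⟩))
    (fun i hi => Fin.ext ((adj hx hi).resolve_right fun h => not_both hx h.2).1)
    (fun i hi => Fin.ext
      (Nat.succ_injective ((adj hx' hi).resolve_left fun h => not_both h.2 hx').1))
  have hE := hL.isEar_attachPath (by omega) hdisj hb hx hx'
  have hU := ((isSimpleLeafless_range_iff Sum.inl_injective).2 hH).union_ear hL hE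
  rwa [Set.range_inl_union_range_inr] at hU

variable {T : SimpleGraph W}

/-- The common edge of the first two members of the cycle and the common edge of the last two lie
on different sides of the vertex at which the path of the last member leaves the first path. -/
theorem HellyRep.exists_isSimpleLeafless_cycleGraph (hT : T.IsTree) {n : ℕ} (hn : 2 ≤ n)
    {s t : Fin (n + 2) → W} (hR : HellyRep (cycleGraph (n + 2)) T s t) :
    ∃ q, IsSimpleLeafless (Uses T s t q) Set.univ := by
  have hn' : 1 ≤ n := by omega
  have share {i j : Fin (n + 2)} (hij : (cycleGraph (n + 2)).Adj i j) :=
    (hR.adj_iff i j hij.ne).1 hij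
  obtain ⟨f, hf₀, hf⟩ := share ((cycleGraph_adj_castSucc_last_iff hn').2 (Or.inl rfl))
  obtain ⟨g, hgn, hg⟩ := share ((cycleGraph_adj_castSucc_last_iff hn').2 (Or.inr rfl))
  have hg₀ : g ∉ between T (s 0) (t 0) := by
    intro hg₀
    have hlt : (0 : Fin (n + 2)) < (Fin.last n).castSucc := by
      simp only [Fin.lt_def, Fin.val_zero, Fin.val_castSucc, Fin.val_last]
      omega
    have hadj := (hR.adj_iff 0 (Fin.last n).castSucc hlt.ne).2 ⟨g, hg₀, hgn⟩
    rw [cycleGraph_adj_iff_of_lt (by omega) hlt, Fin.val_castSucc, Fin.val_last,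
      Fin.val_zero] at hadj
    omega
  obtain ⟨q, y, z, u, hy, h₀y, hz, h₀z, hu, huq, huz⟩ := exists_turn hT hf hf₀ hg hg₀
  exact ⟨q, (hR.localStar hT q).isSimpleLeafless_cycleGraph hn hy hz h₀y h₀z
    ⟨g, hgn, u, hu, huq, huz⟩⟩

theorem isSimpleLeafless_univ_of_equiv {X : Type*} {inc : V → W → Prop} (e : X ≃ V)
    (h : IsSimpleLeafless (fun x => inc (e x)) Set.univ) : IsSimpleLeafless inc Set.univ := by
  rw [← e.range_eq_univ]
  exact (isSimpleLeafless_range_iff e.injective).2 h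

theorem _root_.IsGate.nonempty {G : SimpleGraph V} (hG : IsGate G) : Nonempty V := by
  cases hG with
  | cycle _ n hn e => exact ⟨e.symm ⟨0, by omega⟩⟩
  | attach H _ _ _ _ _ _ l hl _ e => exact ⟨e.symm (Sum.inr ⟨0, by omega⟩)⟩

theorem _root_.IsGate.exists_isSimpleLeafless (hT : T.IsTree) {G : SimpleGraph V} (hG : IsGate G)
    {s t : V → W} (hR : HellyRep G T s t) : ∃ q, IsSimpleLeafless (Uses T s t q) Set.univ := by
  induction hG with
  | cycle G n hn e =>
    obtain ⟨m, rfl⟩ : ∃ m, n = m + 2 := ⟨n - 2, by omega⟩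
    obtain ⟨q, hq⟩ := (hR.comp e.symm.toEmbedding).exists_isSimpleLeafless_cycleGraph hT (by omega)
    exact ⟨q, isSimpleLeafless_univ_of_equiv (inc := Uses T s t q) e.symm.toEquiv hq⟩
  | attach H hH C C' hC hC' hdisj l hl G e ih =>
    have := hH.nonempty
    have hR' := hR.comp e.symm.toEmbedding
    obtain ⟨q, hq⟩ := ih (hR'.comp (embeddingAttachPath H C C' l))
    exact ⟨q, isSimpleLeafless_univ_of_equiv (inc := Uses T s t q) e.symm.toEquiv
      ((hR'.localStar hT q).isSimpleLeafless_attachPath hl hC hC' hdisj hq)⟩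

theorem _root_.IsGate.ncard_maximal_isClique_le [Finite W] (hT : T.IsTree) {G : SimpleGraph V}
    (hG : IsGate G) {s t : V → W} (hR : HellyRep G T s t) :
    ∃ q, {C : Set V | Maximal G.IsClique C}.ncard ≤ (T.neighborSet q).ncard := by
  obtain ⟨q, hq⟩ := hG.exists_isSimpleLeafless hT hR
  have := hG.nonempty
  refine ⟨q, ?_⟩
  rw [hq.ncard_maximal_isClique (hR.localStar hT q)]
  refine Set.ncard_le_ncard ?_
  rintro y ⟨v, -, hv⟩
  exact hv.1

end Gates

section Reachability

variable {V : Type u} {W : Type v} {H : SimpleGraph W}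

theorem reachable_of_forall_adj_reachable {G : SimpleGraph V} (f : V → W)
    (hf : ∀ x y, G.Adj x y → H.Reachable (f x) (f y)) {x y : V} (h : G.Reachable x y) :
    H.Reachable (f x) (f y) := by
  obtain ⟨p⟩ := h
  induction p with
  | nil => rfl
  | cons hxy _ ih => exact (hf _ _ hxy).trans ih

theorem iff_of_reachable {P : W → Prop} (hP : ∀ x y, H.Adj x y → (P x ↔ P y)) {x y : W}
    (h : H.Reachable x y) : P x ↔ P y := by
  obtain ⟨p⟩ := h
  induction p with
  | nil => rfl
  | cons hxy _ ih => exact (hP _ _ hxy).trans ih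

theorem reachable_of_le {l : ℕ} {b : Fin (l + 1) → W} {i k : Fin (l + 1)} (hik : i ≤ k)
    (hadj : ∀ j : Fin l, i ≤ j.castSucc → j.succ ≤ k → H.Adj (b j.castSucc) (b j.succ)) :
    H.Reachable (b i) (b k) := by
  induction k using Fin.induction with
  | zero => rw [le_antisymm hik (Fin.zero_le i)]
  | succ k ih =>
    rcases hik.eq_or_lt with rfl | hik
    · rfl
    · have hik' : i ≤ k.castSucc := Fin.le_castSucc_iff.2 hik
      exact (ih hik' fun j hij hjk => hadj j hij (hjk.trans k.castSucc_le_succ)).trans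
        (hadj k hik' le_rfl).reachable

theorem exists_isPath_first_mem {K : Set W} {x z : W} (h : H.Reachable x z) (hz : z ∈ K) :
    ∃ y ∈ K, ∃ p : H.Walk x y, p.IsPath ∧ ∀ w ∈ p.support, w ∈ K → w = y := by
  classical
  obtain ⟨p, hp⟩ := h.exists_isPath
  have hex : ∃ n, p.getVert n ∈ K := ⟨p.length, by rwa [Walk.getVert_length]⟩
  refine ⟨_, Nat.find_spec hex, p.take (Nat.find hex), hp.take _, fun w hw hwK => ?_⟩
  obtain ⟨m, rfl, -⟩ := Walk.mem_support_iff_exists_getVert.1 hw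
  rw [Walk.take_getVert] at hwK ⊢
  rw [min_eq_left (le_min_iff.1 (Nat.find_min' hex hwK)).2]

theorem ne_of_mem_support_deleteIncidenceSet {q x y z : W}
    (p : (H.deleteIncidenceSet q).Walk x y) (hx : x ≠ q) (hz : z ∈ p.support) : z ≠ q := by
  induction p with
  | nil => rwa [List.mem_singleton.1 hz]
  | cons h _ ih =>
    rcases List.mem_cons.1 hz with rfl | hz
    exacts [hx, ih (deleteIncidenceSet_adj.1 h).2.2 hz]

end Reachability

section Connectivity

variable {V : Type u} {W : Type v} {G : SimpleGraph V} {vis inc : V → W → Prop} {N K : Set W}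
  {S X : Set V} {l : ℕ} {b : Fin (l + 1) → W} {e : Fin l → V}

/-- The graph on the points in which two points are adjacent if a member of `X` joins them. -/
def linkGraph (inc : V → W → Prop) (X : Set V) : SimpleGraph W where
  Adj y z := y ≠ z ∧ ∃ v ∈ X, inc v y ∧ inc v z
  symm := ⟨fun _ _ ⟨hne, v, hv, hy, hz⟩ => ⟨hne.symm, v, hv, hz, hy⟩⟩
  loopless := ⟨fun _ h => h.1 rfl⟩

theorem linkGraph_mono {X Y : Set V} (h : X ⊆ Y) : linkGraph inc X ≤ linkGraph inc Y :=
  fun _ _ ⟨hne, v, hv, hvyz⟩ => ⟨hne, v, h hv, hvyz⟩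

theorem exists_isLinkPath_of_isPath {x y : W} {p : (linkGraph inc X).Walk x y} (hp : p.IsPath) :
    ∃ e : Fin p.length → V, (∀ i, e i ∈ X) ∧
      IsLinkPath inc (fun i : Fin (p.length + 1) => p.getVert i) e := by
  choose e he left right using fun i : Fin p.length => (p.adj_getVert_succ i.2).2
  refine ⟨e, he, fun i j hij => ?_, left, right⟩
  exact Fin.ext (hp.getVert_injOn (Nat.le_of_lt_succ i.2) (Nat.le_of_lt_succ j.2) hij)

/-- The points of `N` cannot be separated from each other by removing one of them from the link
graph of `X`. -/
def TwoConnected (inc : V → W → Prop) (N : Set W) (X : Set V) : Prop :=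
  ∀ a ∈ N, ∀ y ∈ N, ∀ z ∈ N, y ≠ a → z ≠ a →
    ((linkGraph inc X).deleteIncidenceSet a).Reachable y z

/-- The ear leaves `K` through a link `y x'` and returns to `K` along a path avoiding `y`. -/
theorem TwoConnected.exists_isEar (h : TwoConnected inc N X) (hN : ∀ v y, inc v y → y ∈ N)
    (hKN : K ⊆ N) (hK : K.Nontrivial) {x : W} (hxN : x ∈ N) (hxK : x ∉ K) :
    ∃ (l : ℕ) (b : Fin (l + 1) → W) (e : Fin l → V), IsEar inc K b e ∧ ∀ i, e i ∈ X := by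
  obtain ⟨k₁, hk₁, k₂, hk₂, hk⟩ := hK
  obtain ⟨p⟩ := h k₂ (hKN hk₂) k₁ (hKN hk₁) x hxN hk (fun h => hxK (h ▸ hk₂))
  obtain ⟨⟨⟨y, x'⟩, hyx⟩, -, hyK : y ∈ K, hxK' : x' ∉ K⟩ := p.exists_boundary_dart K hk₁ hxK
  replace hyx := (deleteIncidenceSet_adj.1 hyx).1
  obtain ⟨k, hkK, hky⟩ := Set.Nontrivial.exists_ne ⟨k₁, hk₁, k₂, hk₂, hk⟩ y
  have hx'N : x' ∈ N := by
    obtain ⟨-, v, -, -, hv⟩ := hyx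
    exact hN v x' hv
  obtain ⟨z, hzK, r, hr, hrK⟩ :=
    exists_isPath_first_mem (h y (hKN hyK) x' hx'N k (hKN hkK) hyx.ne' hky) hkK
  have hle := (linkGraph inc X).deleteIncidenceSet_le y
  have hpath : (Walk.cons hyx (r.mapLe hle)).IsPath := by
    refine (hr.mapLe hle).cons fun hy => ?_
    rw [Walk.support_mapLe_eq_support] at hy
    exact ne_of_mem_support_deleteIncidenceSet r hyx.ne' hy rfl
  obtain ⟨e, heX, he⟩ := exists_isLinkPath_of_isPath hpath
  have hlen : r.length ≠ 0 := fun h0 => hxK' (Walk.eq_of_length_eq_zero h0 ▸ hzK)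
  refine ⟨_, _, e, ⟨he, ?_, ?_, ?_, fun i hi₀ hi₁ hiK => hi₁ ?_⟩, heX⟩
  · rw [Walk.length_cons, Walk.length_map]
    omega
  · exact hyK
  · simpa only [Fin.val_last, Walk.getVert_length] using hzK
  · obtain ⟨j, rfl⟩ := Fin.exists_succ_eq.2 hi₀
    refine he.injective ?_
    simp only [Fin.val_succ, Walk.getVert_cons_succ, Fin.val_last, Walk.getVert_length] at hiK ⊢
    refine hrK _ ?_ hiK
    rw [← Walk.support_mapLe_eq_support hle r]
    exact Walk.getVert_mem_support _ _

theorem IsLinkPath.linkGraph_adj (h : IsLinkPath inc b e) {i : Fin l} (hi : e i ∈ X) :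
    (linkGraph inc X).Adj (b i.castSucc) (b i.succ) :=
  ⟨h.castSucc_ne_succ i, e i, hi, h.left i, h.right i⟩

theorem IsLinkPath.reachable_start_or_end (hL : LocalStar G vis inc) (h : IsLinkPath inc b e)
    (w : V) (i : Fin (l + 1)) :
    (linkGraph inc (Set.range e \ {w})).Reachable (b 0) (b i) ∨
      (linkGraph inc (Set.range e \ {w})).Reachable (b (Fin.last l)) (b i) := by
  by_cases hw : ∃ j, j.succ ≤ i ∧ e j = w
  · obtain ⟨j, hji, rfl⟩ := hw
    right
    symm
    refine reachable_of_le (Fin.le_last i) fun k hik _ => h.linkGraph_adj ⟨⟨k, rfl⟩, fun hkj => ?_⟩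
    obtain rfl := h.edge_injective hL hkj
    exact (hji.trans hik).not_gt k.castSucc_lt_succ
  · left
    exact reachable_of_le (Fin.zero_le i) fun k _ hki =>
      h.linkGraph_adj ⟨⟨k, rfl⟩, fun hkw => hw ⟨k, hki, hkw⟩⟩

/-- The points of `S` cannot be separated from each other by removing a member from `S`. -/
def TwoEdgeConnected (inc : V → W → Prop) (S : Set V) : Prop :=
  ∀ w, ∀ y ∈ points inc S, ∀ z ∈ points inc S, (linkGraph inc (S \ {w})).Reachable y z

namespace IsEar

theorem mem_points_or (hL : LocalStar G vis inc) (h : IsEar inc (points inc S) b e) {y : W}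
    (hy : y ∈ points inc (S ∪ Set.range e)) : y ∈ points inc S ∨ ∃ i, b i = y := by
  obtain ⟨v, hv | ⟨i, rfl⟩, hy⟩ := hy
  · exact Or.inl ⟨v, hv, hy⟩
  · rcases h.eq_or_eq hL hy with rfl | rfl <;> exact Or.inr ⟨_, rfl⟩

theorem twoEdgeConnected_union (hL : LocalStar G vis inc) (hE : IsEar inc (points inc S) b e)
    (h : ∀ w, ∀ y ∈ points inc S, ∀ z ∈ points inc S,
      (linkGraph inc ((S ∪ Set.range e) \ {w})).Reachable y z) :
    TwoEdgeConnected inc (S ∪ Set.range e) := by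
  intro w
  have hmono : linkGraph inc (Set.range e \ {w}) ≤ linkGraph inc ((S ∪ Set.range e) \ {w}) :=
    linkGraph_mono (Set.sdiff_subset_sdiff_left Set.subset_union_right)
  have from_start : ∀ y ∈ points inc (S ∪ Set.range e),
      (linkGraph inc ((S ∪ Set.range e) \ {w})).Reachable (b 0) y := by
    intro y hy
    rcases hE.mem_points_or hL hy with hy | ⟨i, rfl⟩
    · exact h w _ hE.start_mem _ hy
    · rcases hE.reachable_start_or_end hL w i with h' | h'
      · exact h'.mono hmono
      · exact (h w _ hE.start_mem _ hE.end_mem).trans (h'.mono hmono)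
  exact fun y hy z hz => (from_start y hy).symm.trans (from_start z hz)

theorem reachable_deleteIncidenceSet (hE : IsEar inc (points inc S) b e) (heX : ∀ i, e i ∈ X)
    (hSX : S ⊆ X) (hS : TwoEdgeConnected inc S) {v : V} (hv : v ∈ S) {a : W} (ha₀ : b 0 ≠ a)
    (ha₁ : b (Fin.last l) ≠ a) :
    ((linkGraph inc (X \ {v})).deleteIncidenceSet a).Reachable (b 0) (b (Fin.last l)) := by
  by_cases ha : ∃ i, b i = a
  · obtain ⟨i, rfl⟩ := ha
    have hi := hE.notMem i (fun h => ha₀ (h ▸ rfl)) (fun h => ha₁ (h ▸ rfl))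
    refine (hS v _ hE.start_mem _ hE.end_mem).mono ?_
    rintro c d ⟨hcd, x, hx, hxc, hxd⟩
    refine deleteIncidenceSet_adj.2 ⟨⟨hcd, x, ⟨hSX hx.1, hx.2⟩, hxc, hxd⟩, ?_, ?_⟩
    · rintro rfl
      exact hi ⟨x, hx.1, hxc⟩
    · rintro rfl
      exact hi ⟨x, hx.1, hxd⟩
  · push Not at ha
    refine reachable_of_le (Fin.zero_le _) fun j _ _ => ?_
    have hj : e j ∈ X \ {v} := ⟨heX j, fun h => hE.edge_notMem j (h ▸ hv)⟩
    exact deleteIncidenceSet_adj.2 ⟨hE.linkGraph_adj hj, ha _, ha _⟩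

end IsEar

/-- The points of `v` stay linked by the ear, or by `S` if a point of the ear is removed. -/
theorem TwoConnected.diff_singleton (h : TwoConnected inc N X) (hL : LocalStar G vis inc)
    (hSX : S ⊆ X) (hS : TwoEdgeConnected inc S) (hE : IsEar inc (points inc S) b e)
    (heX : ∀ i, e i ∈ X) {v : V} (hvS : v ∈ S) (hv₀ : inc v (b 0)) (hv₁ : inc v (b (Fin.last l))) :
    TwoConnected inc N (X \ {v}) := by
  have hne : b 0 ≠ b (Fin.last l) := hE.start_ne_end (by have := hE.two_le; omega)
  intro a ha y hy z hz hya hza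
  refine reachable_of_forall_adj_reachable id ?_ (h a ha y hy z hz hya hza)
  intro y z hyz
  obtain ⟨⟨hyz, w, hw, hwy, hwz⟩, hya, hza⟩ := deleteIncidenceSet_adj.1 hyz
  by_cases hwv : w = v
  · obtain rfl := hwv
    have ends := hE.reachable_deleteIncidenceSet heX hSX hS hvS (a := a)
    rcases hL.eq_or_eq hv₀ hv₁ hne (hL.vis_of_inc hwy) with rfl | rfl <;>
      rcases hL.eq_or_eq hv₀ hv₁ hne (hL.vis_of_inc hwz) with rfl | rfl
    · exact (hyz rfl).elim
    · exact ends hya hza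
    · exact (ends hza hya).symm
    · exact (hyz rfl).elim
  · have hadj : (linkGraph inc (X \ {v})).Adj y z := ⟨hyz, w, ⟨hw, hwv⟩, hwy, hwz⟩
    exact (deleteIncidenceSet_adj.2 ⟨hadj, hya, hza⟩).reachable

end Connectivity

section InducedGates

variable {V : Type u} {W : Type v} {G : SimpleGraph V} {vis inc : V → W → Prop} {N : Set W}
  {S X : Set V} {l : ℕ} {b : Fin (l + 1) → W} {e : Fin l → V}

/-- An embedded graph is isomorphic to the subgraph induced on its image. -/
noncomputable def isoInduceRange {U : Type*} {H : SimpleGraph U} (f : H ↪g G) :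
    H ≃g G.induce (Set.range f) :=
  ⟨Equiv.ofInjective f f.injective, f.map_adj_iff⟩

theorem IsLinkPath.adj_iff (hL : LocalStar G vis inc) (h : IsLinkPath inc b e) {i j : Fin l} :
    G.Adj (e i) (e j) ↔ (pathGraph l).Adj i j := by
  rw [pathGraph_adj]
  constructor
  · intro hadj
    have hij : i ≠ j := fun hij => hadj.ne (congrArg e hij)
    obtain ⟨y, hi, hj⟩ := (hL.adj_iff hadj.ne (h.through i) (h.through j)).1 hadj
    rcases h.eq_or_eq hL hi with rfl | rfl <;> rcases h.eq_or_eq hL hj with hb | hb <;>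
      replace hb := congrArg Fin.val (h.injective hb) <;>
      simp only [Fin.val_castSucc, Fin.val_succ] at hb <;> omega
  · have next {i j : Fin l} (hij : i.val + 1 = j.val) : G.Adj (e i) (e j) := by
      have hb : i.succ = j.castSucc := Fin.ext hij
      exact hL.adj_of_inc ((h.edge_injective hL).ne (by omega)) (h.right i) (hb ▸ h.left j)
    rintro (hij | hij)
    exacts [next hij, (next hij).symm]

theorem IsEar.adj_iff_of_mem (hL : LocalStar G vis inc) (hE : IsEar inc (points inc S) b e)
    {v : V} (hvS : v ∈ S) (hv : Through inc v) {i : Fin l} :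
    G.Adj v (e i) ↔ (i.val = 0 ∧ inc v (b 0)) ∨ (i.val + 1 = l ∧ inc v (b (Fin.last l))) := by
  have hne : v ≠ e i := fun h => hE.edge_notMem i (h ▸ hvS)
  rw [hL.adj_iff hne hv (hE.through i)]
  constructor
  · have is_end (k : Fin (l + 1)) (hk : inc v (b k)) : k = 0 ∨ k = Fin.last l := by
      by_contra! hc
      exact hE.notMem k hc.1 hc.2 ⟨v, hvS, hk⟩
    rintro ⟨y, hvy, hiy⟩
    rcases hE.eq_or_eq hL hiy with rfl | rfl
    · have hi := (is_end _ hvy).resolve_right i.castSucc_lt_last.ne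
      exact Or.inl ⟨congrArg Fin.val hi, hi ▸ hvy⟩
    · have hi := (is_end _ hvy).resolve_left (Fin.succ_ne_zero i)
      exact Or.inr ⟨congrArg Fin.val hi, hi ▸ hvy⟩
  · rintro (⟨hi, hv⟩ | ⟨hi, hv⟩)
    · have hi : i.castSucc = 0 := Fin.ext hi
      exact ⟨_, hv, hi ▸ hE.left i⟩
    · have hi : i.succ = Fin.last l := Fin.ext hi
      exact ⟨_, hv, hi ▸ hE.right i⟩

theorem IsSimpleLeafless.induce (h : IsSimpleLeafless inc S) :
    IsSimpleLeafless (fun v : S => inc v) Set.univ :=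
  (isSimpleLeafless_range_iff Subtype.val_injective).1 (by rwa [Subtype.range_coe])

theorem points_induce (inc : V → W → Prop) (S : Set V) :
    points (fun v : S => inc v) Set.univ = points inc S := by
  ext y
  simp only [points, Set.mem_univ, true_and, Subtype.exists, exists_prop, Set.mem_ofPred_eq]

theorem isGate_induce_union_ear (hL : LocalStar G vis inc) (hE : IsEar inc (points inc S) b e)
    (hS : IsSimpleLeafless inc S) (hG : IsGate (G.induce S))
    (hchord : ∀ v ∈ S, inc v (b 0) → ¬ inc v (b (Fin.last l))) :
    IsGate (G.induce (S ∪ Set.range e)) := by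
  have hmax {y} (hy : y ∈ points inc S) : Maximal (G.induce S).IsClique {v : S | inc v y} :=
    hS.induce.maximal_isClique (hL.comap (Embedding.induce S)) (by rwa [points_induce])
  let H := attachPath (G.induce S) {v | inc v (b 0)} {v | inc v (b (Fin.last l))} l
  have hcross (v : S) (i : Fin l) : G.Adj v (e i) ↔ H.Adj (Sum.inl v) (Sum.inr i) := by
    rw [attachPath_adj_inl_inr, hE.adj_iff_of_mem hL v.2 (hS.through v.2)]
    rfl
  let f : H ↪g G :=
    { toFun := Sum.elim Subtype.val e
      inj' := Subtype.val_injective.sumElim (hE.edge_injective hL)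
        fun v i h => hE.edge_notMem i (h ▸ v.2)
      map_rel_iff' := by
        rintro (v | i) (w | j)
        · exact ((embeddingAttachPath (G.induce S) _ _ l).map_adj_iff (v := v) (w := w)).symm
        · exact hcross v j
        · rw [adj_comm, adj_comm H]
          exact hcross w i
        · exact (hE.adj_iff hL).trans
            ((pathGraphEmbeddingAttachPath (G.induce S) _ _ l).map_adj_iff (v := i) (w := j)).symm }
  have hf : Set.range f = S ∪ Set.range e := by
    refine (Set.Sum.elim_range _ _).trans ?_
    rw [Subtype.range_coe]
  rw [← hf]
  exact .attach (G.induce S) hG _ _ (hmax hE.start_mem) (hmax hE.end_mem)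
    (Set.disjoint_left.2 fun v => hchord v v.2) l hE.two_le _ (isoInduceRange f).symm

theorem isGate_induce_insert_ear (hL : LocalStar G vis inc) {v : V}
    (hE : IsEar inc (points inc {v}) b e) (hl : 3 ≤ l) :
    IsGate (G.induce (insert v (Set.range e))) := by
  obtain ⟨n, rfl⟩ : ∃ n, l = n + 1 := ⟨l - 1, by omega⟩
  have hn : 1 ≤ n := by omega
  have hv₀ := mem_points_singleton.1 hE.start_mem
  have hv₁ := mem_points_singleton.1 hE.end_mem
  have hv : Through inc v := ⟨_, _, hE.start_ne_end (by omega), hv₀, hv₁⟩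
  have hlast (i : Fin (n + 1)) :
      G.Adj (e i) v ↔ (cycleGraph (n + 2)).Adj i.castSucc (Fin.last (n + 1)) := by
    rw [adj_comm, hE.adj_iff_of_mem hL rfl hv, cycleGraph_adj_castSucc_last_iff hn]
    simp only [hv₀, hv₁, and_true, Fin.ext_iff, Fin.val_zero, Fin.val_last,
      Nat.add_right_cancel_iff]
  let c : Fin (n + 2) → V := Fin.snoc e v
  have hc (i : Fin (n + 1)) : c i.castSucc = e i := Fin.snoc_castSucc (α := fun _ => V) v e i
  have hcv : c (Fin.last (n + 1)) = v := Fin.snoc_last (α := fun _ => V) v e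
  let f : cycleGraph (n + 2) ↪g G :=
    { toFun := c
      inj' := Fin.snoc_injective_of_injective (hE.edge_injective hL)
        (by rintro ⟨i, hi⟩; exact hE.edge_notMem i hi)
      map_rel_iff' := by
        intro i j
        change G.Adj (c i) (c j) ↔ _
        cases i using Fin.lastCases with
        | last =>
          cases j using Fin.lastCases with
          | last => simp only [SimpleGraph.irrefl]
          | cast j =>
            rw [adj_comm, adj_comm (cycleGraph _), hcv, hc]
            exact hlast j
        | cast i =>
          cases j using Fin.lastCases with
          | last =>
            rw [hcv, hc]
            exact hlast i
          | cast j =>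
            rw [hc, hc, hE.adj_iff hL]
            exact (pathGraphEmbeddingCycleGraph hn).map_adj_iff.symm }
  have hf : Set.range f = insert v (Set.range e) := Fin.range_snoc e v
  rw [← hf]
  exact .cycle _ (n + 2) (by omega) (isoInduceRange f).symm

/-- `S` induces a gate whose link graph is as it arises from a cycle by adding ears. -/
structure IsGateOn (G : SimpleGraph V) (inc : V → W → Prop) (S : Set V) : Prop where
  isGate : IsGate (G.induce S)
  isSimpleLeafless : IsSimpleLeafless inc S
  twoEdgeConnected : TwoEdgeConnected inc S

/-- A triangle of the link graph is a clique of `G`, so that it would have a common point. -/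
theorem IsEar.three_le (hL : LocalStar G vis inc) {v : V} (hE : IsEar inc (points inc {v}) b e) :
    3 ≤ l := by
  by_contra! hl
  obtain rfl : l = 2 := le_antisymm (by omega) hE.two_le
  have hv₀ := mem_points_singleton.1 hE.start_mem
  have hv₁ := mem_points_singleton.1 hE.end_mem
  have hne : b 0 ≠ b 2 := hE.start_ne_end two_ne_zero
  have hv : Through inc v := ⟨_, _, hne, hv₀, hv₁⟩
  have hadj₀ : G.Adj v (e 0) := (hE.adj_iff_of_mem hL rfl hv).2 (Or.inl ⟨rfl, hv₀⟩)
  have hadj₁ : G.Adj v (e 1) := (hE.adj_iff_of_mem hL rfl hv).2 (Or.inr ⟨rfl, hv₁⟩)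
  have hadj : G.Adj (e 0) (e 1) := (hE.adj_iff hL).2 (pathGraph_adj.2 (Or.inl rfl))
  obtain ⟨y, hy⟩ := hL.helly {v, e 0, e 1} (Set.insert_nonempty _ _)
    (by simp only [isClique_insert, isClique_singleton, Set.mem_insert_iff, Set.mem_singleton_iff,
          forall_eq_or_imp, forall_eq, hadj₀, hadj₁, hadj, implies_true, and_self])
  simp only [Set.mem_insert_iff, Set.mem_singleton_iff, forall_eq_or_imp, forall_eq] at hy
  rcases hL.eq_or_eq hv₀ hv₁ hne hy.1 with rfl | rfl
  · rcases hE.eq_or_eq hL (hL.inc_of_through (hE.through 1) hy.2.2) with h | h <;>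
      cases hE.injective h
  · rcases hE.eq_or_eq hL (hL.inc_of_through (hE.through 0) hy.2.1) with h | h <;>
      cases hE.injective h

theorem IsEar.isGateOn_insert (hL : LocalStar G vis inc) {v : V}
    (hE : IsEar inc (points inc {v}) b e) : IsGateOn G inc (insert v (Set.range e)) where
  isGate := isGate_induce_insert_ear hL hE (hE.three_le hL)
  isSimpleLeafless := hE.isSimpleLeafless_insert hL
  twoEdgeConnected := by
    have hv₀ := mem_points_singleton.1 hE.start_mem
    have hv₁ := mem_points_singleton.1 hE.end_mem
    have hne : b 0 ≠ b (Fin.last l) := hE.start_ne_end (by have := hE.two_le; omega)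
    rw [← Set.singleton_union]
    refine hE.twoEdgeConnected_union hL fun w y hy z hz => ?_
    have ends : (linkGraph inc (({v} ∪ Set.range e) \ {w})).Reachable (b 0) (b (Fin.last l)) := by
      by_cases hvw : v = w
      · refine reachable_of_le (Fin.zero_le _) fun i _ _ => ?_
        have hi : e i ∈ ({v} ∪ Set.range e) \ {w} :=
          ⟨Or.inr ⟨i, rfl⟩, fun hi => hE.edge_notMem i (hi.trans hvw.symm)⟩
        exact hE.linkGraph_adj hi
      · have hadj : (linkGraph inc (({v} ∪ Set.range e) \ {w})).Adj (b 0) (b (Fin.last l)) :=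
          ⟨hne, v, ⟨Or.inl rfl, hvw⟩, hv₀, hv₁⟩
        exact hadj.reachable
    rcases hL.eq_or_eq hv₀ hv₁ hne (hL.vis_of_inc (mem_points_singleton.1 hy)) with rfl | rfl <;>
      rcases hL.eq_or_eq hv₀ hv₁ hne (hL.vis_of_inc (mem_points_singleton.1 hz)) with rfl | rfl
    exacts [.rfl, ends, ends.symm, .rfl]

theorem IsGateOn.union_ear (hL : LocalStar G vis inc) (hS : IsGateOn G inc S)
    (hE : IsEar inc (points inc S) b e)
    (hchord : ∀ v ∈ S, inc v (b 0) → ¬ inc v (b (Fin.last l))) :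
    IsGateOn G inc (S ∪ Set.range e) where
  isGate := isGate_induce_union_ear hL hE hS.isSimpleLeafless hS.isGate hchord
  isSimpleLeafless := hS.isSimpleLeafless.union_ear hL hE
  twoEdgeConnected := hE.twoEdgeConnected_union hL fun w y hy z hz =>
    (hS.twoEdgeConnected w y hy z hz).mono
      (linkGraph_mono (Set.sdiff_subset_sdiff_left Set.subset_union_left))

theorem IsGateOn.nontrivial_points (hS : IsGateOn G inc S) : (points inc S).Nontrivial := by
  obtain ⟨v, hv⟩ := hS.isGate.nonempty
  obtain ⟨y, z, hyz, hy, hz⟩ := hS.isSimpleLeafless.through hv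
  exact ⟨y, ⟨v, hv, hy⟩, z, ⟨v, hv, hz⟩, hyz⟩

theorem IsGateOn.isKGate (hL : LocalStar G vis inc) (hS : IsGateOn G inc S) :
    IsKGate (points inc S).ncard (G.induce S) := by
  have := hS.isGate.nonempty
  refine ⟨hS.isGate, ?_⟩
  rw [hS.isSimpleLeafless.induce.ncard_maximal_isClique (hL.comap (Embedding.induce S))]
  exact congrArg Set.ncard (points_induce inc S)

namespace TwoConnected

theorem exists_finite (h : TwoConnected inc N X) (hNfin : N.Finite) (hN : ∀ v y, inc v y → y ∈ N) :
    ∃ Y ⊆ X, Y.Finite ∧ TwoConnected inc N Y := by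
  choose f hfX hf using fun p : {p : W × W // (linkGraph inc X).Adj p.1 p.2} => p.2.2
  have : Finite {p : W × W // (linkGraph inc X).Adj p.1 p.2} :=
    (hNfin.prod hNfin).subset fun p hp => ⟨hN _ _ hp.2.choose_spec.2.1, hN _ _ hp.2.choose_spec.2.2⟩
  have hle : linkGraph inc X ≤ linkGraph inc (Set.range f) :=
    fun y z hyz => ⟨hyz.1, f ⟨(y, z), hyz⟩, ⟨_, rfl⟩, hf ⟨(y, z), hyz⟩⟩
  refine ⟨Set.range f, Set.range_subset_iff.2 hfX, Set.finite_range f, ?_⟩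
  exact fun a ha y hy z hz hya hza =>
    (h a ha y hy z hz hya hza).mono fun _ _ hadj =>
      have ⟨hadj, ha⟩ := deleteIncidenceSet_adj.1 hadj
      deleteIncidenceSet_adj.2 ⟨hle hadj, ha⟩

theorem exists_finite_minimal (h : TwoConnected inc N X) (hNfin : N.Finite)
    (hN : ∀ v y, inc v y → y ∈ N) : ∃ Y, Y.Finite ∧ Minimal (TwoConnected inc N) Y := by
  obtain ⟨Y, -, hY, hYc⟩ := h.exists_finite hNfin hN
  obtain ⟨Z, hZ⟩ := (hY.finite_subsets.subset fun Z (hZ : Z ⊆ Y ∧ TwoConnected inc N Z) =>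
    hZ.1).exists_minimal ⟨Y, subset_rfl, hYc⟩
  refine ⟨Z, hY.subset hZ.1.1, hZ.1.2, fun Z' hZ' hle => hZ.2 ⟨hle.trans hZ.1.1, hZ'⟩ hle⟩

theorem exists_isGateOn (h : TwoConnected inc N X) (hL : LocalStar G vis inc)
    (hN : ∀ v y, inc v y → y ∈ N) (hcard : 2 < N.ncard) : ∃ S ⊆ X, IsGateOn G inc S := by
  obtain ⟨a, y, z, ha, hy, hz, hay, haz, hyz⟩ :=
    (Set.two_lt_ncard_iff (Set.finite_of_ncard_pos (by omega))).1 hcard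
  obtain ⟨p⟩ := h a ha y hy z hz hay.symm haz.symm
  obtain ⟨⟨hyw, v, hvX, hvy, hvw⟩, hya, hwa⟩ :=
    deleteIncidenceSet_adj.1 (p.adj_snd (Walk.not_nil_of_ne hyz))
  obtain ⟨l, b, e, hE, heX⟩ := h.exists_isEar (K := points inc {v}) hN
    (fun x hx => hN v x (mem_points_singleton.1 hx))
    ⟨y, mem_points_singleton.2 hvy, _, mem_points_singleton.2 hvw, hyw⟩ ha
    (fun hav => by
      rcases hL.eq_or_eq hvy hvw hyw (hL.vis_of_inc (mem_points_singleton.1 hav)) with h | h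
      exacts [hya h.symm, hwa h.symm])
  exact ⟨_, Set.insert_subset hvX (Set.range_subset_iff.2 heX), hE.isGateOn_insert hL⟩

/-- In a minimal two-connected family every ear of a gate is chordless. -/
theorem exists_isKGate (h : TwoConnected inc N X) (hL : LocalStar G vis inc)
    (hN : ∀ v y, inc v y → y ∈ N) (hcard : 2 < N.ncard) :
    ∃ S : Set V, IsKGate N.ncard (G.induce S) := by
  obtain ⟨Y, hYfin, hY⟩ := h.exists_finite_minimal (Set.finite_of_ncard_pos (by omega)) hN
  obtain ⟨S₀, hS₀Y, hS₀⟩ := hY.1.exists_isGateOn hL hN hcard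
  obtain ⟨S, hS⟩ := (hYfin.finite_subsets.subset fun S (hS : S ⊆ Y ∧ IsGateOn G inc S) =>
    hS.1).exists_maximal ⟨S₀, hS₀Y, hS₀⟩
  obtain ⟨⟨hSY, hSG⟩, hmax⟩ := hS
  have hSN : points inc S ⊆ N := fun y ⟨v, _, hy⟩ => hN v y hy
  suffices hNS : N ⊆ points inc S from ⟨S, (hSN.antisymm hNS) ▸ hSG.isKGate hL⟩
  by_contra hNS
  obtain ⟨x, hxN, hxS⟩ := Set.not_subset.1 hNS
  obtain ⟨l, b, e, hE, heY⟩ := hY.1.exists_isEar hN hSN hSG.nontrivial_points hxN hxS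
  have hchord (v : V) (hv : v ∈ S) (h₀ : inc v (b 0)) : ¬ inc v (b (Fin.last l)) := fun h₁ =>
    (hY.2 (hY.1.diff_singleton hL hSY hSG.twoEdgeConnected hE heY hv h₀ h₁) Set.sdiff_subset
      (hSY hv)).2 rfl
  have hle := hmax ⟨Set.union_subset hSY (Set.range_subset_iff.2 heY),
    hSG.union_ear hL hE hchord⟩ Set.subset_union_left
  obtain ⟨i, -⟩ := hE.exists_inc_start
  exact hE.edge_notMem i (hle (Or.inr ⟨i, rfl⟩))

end TwoConnected

end InducedGates

section SplitVertex

variable {V : Type u} {W : Type v} {T : SimpleGraph W} {q : W} {A : Set W}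

/-- The graph in which `q` is split into the adjacent vertices `some q` and `none`, where `none`
takes over the neighbors in `A`. -/
def splitVertex (T : SimpleGraph W) (q : W) (A : Set W) : SimpleGraph (Option W) where
  Adj
    | none, none => False
    | none, some w => w = q ∨ w ∈ A
    | some w, none => w = q ∨ w ∈ A
    | some x, some y => T.Adj x y ∧ ¬ (x = q ∧ y ∈ A) ∧ ¬ (y = q ∧ x ∈ A)
  symm := ⟨by
    rintro (_ | x) (_ | y) h
    exacts [h, h, h, ⟨h.1.symm, h.2.2, h.2.1⟩]⟩
  loopless := ⟨by
    rintro (_ | x) h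
    exacts [h, h.1.ne rfl]⟩

theorem splitVertex_adj_none_some {w : W} :
    (splitVertex T q A).Adj none (some w) ↔ w = q ∨ w ∈ A := Iff.rfl

theorem splitVertex_adj_some_none {w : W} :
    (splitVertex T q A).Adj (some w) none ↔ w = q ∨ w ∈ A := Iff.rfl

theorem splitVertex_not_adj_none_none : ¬ (splitVertex T q A).Adj none none := id

theorem splitVertex_adj_some_some {x y : W} :
    (splitVertex T q A).Adj (some x) (some y) ↔
      T.Adj x y ∧ ¬ (x = q ∧ y ∈ A) ∧ ¬ (y = q ∧ x ∈ A) := Iff.rfl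

/-- The contraction of the edge between the two vertices into which `q` was split. -/
def contract (q : W) (x : Option W) : W := x.getD q

theorem map_contract_mem_edgeSet (hA : A ⊆ T.neighborSet q) {g : Sym2 (Option W)}
    (hg : g ∈ (splitVertex T q A).edgeSet) (hne : g ≠ s(none, some q)) :
    g.map (contract q) ∈ T.edgeSet := by
  induction g with
  | h x y =>
    rcases x with _ | x <;> rcases y with _ | y
    · exact hg.elim
    · rcases hg with rfl | hy
      exacts [(hne rfl).elim, hA hy]
    · rcases hg with rfl | hx
      exacts [(hne Sym2.eq_swap).elim, (hA hx).symm]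
    · exact hg.1

theorem exists_map_contract_eq {g : Sym2 W} (hg : g ∈ T.edgeSet) :
    ∃ g' ∈ (splitVertex T q A).edgeSet, g'.map (contract q) = g := by
  induction g with
  | h x y =>
    by_cases hx : x = q ∧ y ∈ A
    · exact ⟨s(none, some y), Or.inr hx.2, hx.1 ▸ rfl⟩
    by_cases hy : y = q ∧ x ∈ A
    · exact ⟨s(some x, none), Or.inr hy.2, hy.1 ▸ rfl⟩
    · exact ⟨s(some x, some y), ⟨hg, hx, hy⟩, rfl⟩

theorem injOn_map_contract :
    Set.InjOn (Sym2.map (contract q)) ((splitVertex T q A).edgeSet \ {s(none, some q)}) := by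
  rintro ⟨x, y⟩ ⟨h, hne⟩ ⟨x', y'⟩ ⟨h', hne'⟩ heq
  rcases x with _ | x <;> rcases y with _ | y <;> rcases x' with _ | x' <;>
    rcases y' with _ | y' <;>
    simp only [contract, Sym2.map_mk, Option.getD_none, Option.getD_some, mem_edgeSet,
      splitVertex_not_adj_none_none, splitVertex_adj_none_some, splitVertex_adj_some_none,
      splitVertex_adj_some_some, Set.mem_singleton_iff, Sym2.eq_iff, Option.some.injEq,
      reduceCtorEq] at * <;>
    grind

theorem reachable_contract (hA : A ⊆ T.neighborSet q) {g : Sym2 (Option W)}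
    (hg : g ∈ (splitVertex T q A).edgeSet) (hne : g ≠ s(none, some q)) {a c : Option W}
    (h : ((splitVertex T q A).deleteEdges {g}).Reachable a c) :
    (T.deleteEdges {g.map (contract q)}).Reachable (contract q a) (contract q c) := by
  refine reachable_of_forall_adj_reachable (contract q) (fun x y hxy => ?_) h
  obtain ⟨hxy, hxyg⟩ := deleteEdges_adj.1 hxy
  by_cases hnew : s(x, y) = s(none, some q)
  · rcases Sym2.eq_iff.1 hnew with ⟨rfl, rfl⟩ | ⟨rfl, rfl⟩ <;> rfl
  · refine Adj.reachable (deleteEdges_adj.2 ⟨map_contract_mem_edgeSet hA hxy hnew, fun heq => ?_⟩)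
    exact hxyg (injOn_map_contract ⟨hxy, hnew⟩ ⟨hg, hne⟩ heq)

theorem reachable_of_reachable_contract {F : Set (Sym2 (Option W))} (hF : s(none, some q) ∉ F)
    {a c : Option W}
    (h : (T.deleteEdges (Sym2.map (contract q) '' F)).Reachable (contract q a) (contract q c)) :
    ((splitVertex T q A).deleteEdges F).Reachable a c := by
  have lift (x : Option W) :
      ((splitVertex T q A).deleteEdges F).Reachable (some (contract q x)) x := by
    rcases x with _ | x
    · have hadj : ((splitVertex T q A).deleteEdges F).Adj none (some q) :=
        deleteEdges_adj.2 ⟨Or.inl rfl, hF⟩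
      exact hadj.symm.reachable
    · rfl
  refine (lift a).symm.trans (Reachable.trans ?_ (lift c))
  refine reachable_of_forall_adj_reachable some (fun x y hxy => ?_) h
  obtain ⟨hxy, hxyF⟩ := deleteEdges_adj.1 hxy
  obtain ⟨⟨x', y'⟩, hadj, heq⟩ := exists_map_contract_eq (q := q) (A := A) (T.mem_edgeSet.2 hxy)
  have hadj' : ((splitVertex T q A).deleteEdges F).Reachable x' y' :=
    Adj.reachable (deleteEdges_adj.2 ⟨hadj, fun hmem => hxyF ⟨_, hmem, heq⟩⟩)
  rcases Sym2.eq_iff.1 heq with ⟨rfl, rfl⟩ | ⟨rfl, rfl⟩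
  · exact (lift x').trans (hadj'.trans (lift y').symm)
  · exact (lift y').trans (hadj'.symm.trans (lift x').symm)

theorem mem_between_splitVertex_iff (hA : A ⊆ T.neighborSet q) {g : Sym2 (Option W)}
    (hg : g ∈ (splitVertex T q A).edgeSet) (hne : g ≠ s(none, some q)) {a c : Option W} :
    g ∈ between (splitVertex T q A) a c ↔
      g.map (contract q) ∈ between T (contract q a) (contract q c) := by
  refine and_congr (iff_of_true hg (map_contract_mem_edgeSet hA hg hne)) (not_congr ?_)
  refine ⟨reachable_contract hA hg hne, fun h => ?_⟩
  exact reachable_of_reachable_contract (Set.mem_singleton_iff.not.2 hne.symm)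
    (by rwa [Set.image_singleton])

/-- The vertices on the side of `none` of the edge between `none` and `some q`. -/
def newSide (hT : T.IsTree) (q : W) (A : Set W) : Set (Option W) :=
  {x | ∀ w ∈ x, branch hT q w ∈ A}

theorem none_mem_newSide (hT : T.IsTree) : none ∈ newSide hT q A := fun _ h => by cases h

theorem some_mem_newSide_iff (hT : T.IsTree) {w : W} :
    some w ∈ newSide hT q A ↔ branch hT q w ∈ A := by
  simp only [newSide, Set.mem_ofPred_eq, Option.mem_some_iff, forall_eq']

theorem branch_self_notMem (hT : T.IsTree) (hA : A ⊆ T.neighborSet q) : branch hT q q ∉ A := by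
  rw [branch_self]
  exact fun h => (hA h).ne rfl

theorem mem_newSide_iff_of_adj (hT : T.IsTree) (hA : A ⊆ T.neighborSet q) {x y : Option W}
    (h : (splitVertex T q A).Adj x y) (hne : s(x, y) ≠ s(none, some q)) :
    x ∈ newSide hT q A ↔ y ∈ newSide hT q A := by
  have mem_of_mem {w : W} (hw : w ∈ A) : some w ∈ newSide hT q A := by
    rwa [some_mem_newSide_iff, branch_of_adj hT (hA hw)]
  have hq := branch_self_notMem hT hA
  rcases x with _ | x <;> rcases y with _ | y
  · rfl
  · rcases h with rfl | hy
    exacts [(hne rfl).elim, iff_of_true (none_mem_newSide hT) (mem_of_mem hy)]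
  · rcases h with rfl | hx
    exacts [(hne Sym2.eq_swap).elim, iff_of_true (mem_of_mem hx) (none_mem_newSide hT)]
  · obtain ⟨hxy, hx, hy⟩ := h
    rw [some_mem_newSide_iff, some_mem_newSide_iff]
    by_cases hxq : x = q
    · subst hxq
      exact iff_of_false hq fun hyA => hx ⟨rfl, branch_of_adj hT hxy ▸ hyA⟩
    by_cases hyq : y = q
    · subst hyq
      exact iff_of_false (fun hxA => hy ⟨rfl, branch_of_adj hT hxy.symm ▸ hxA⟩) hq
    · rw [branch_eq_of_adj hT hxq hyq hxy]

theorem reachable_some_branch (hT : T.IsTree) (w : W) :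
    ((splitVertex T q A).deleteEdges {s(none, some q)}).Reachable
      (some (branch hT q w)) (some w) := by
  refine reachable_of_forall_adj_reachable some (fun x y hxy => ?_)
    (reachable_deleteIncidenceSet_branch hT q w)
  obtain ⟨hxy, hx, hy⟩ := deleteIncidenceSet_adj.1 hxy
  exact Adj.reachable (deleteEdges_adj.2
    ⟨⟨hxy, fun h => hx h.1, fun h => hy h.1⟩, by simp⟩)

theorem reachable_none_of_mem_newSide (hT : T.IsTree) (hA : A ⊆ T.neighborSet q) {x : Option W}
    (hx : x ∈ newSide hT q A) :
    ((splitVertex T q A).deleteEdges {s(none, some q)}).Reachable none x := by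
  rcases x with _ | w
  · rfl
  · have hw := (some_mem_newSide_iff hT).1 hx
    have hadj : ((splitVertex T q A).deleteEdges {s(none, some q)}).Adj none
        (some (branch hT q w)) :=
      deleteEdges_adj.2 ⟨Or.inr hw, by simpa using (hA hw).ne'⟩
    exact hadj.reachable.trans (reachable_some_branch hT w)

theorem reachable_some_of_notMem_newSide (hT : T.IsTree) {x : Option W}
    (hx : x ∉ newSide hT q A) :
    ((splitVertex T q A).deleteEdges {s(none, some q)}).Reachable (some q) x := by
  rcases x with _ | w
  · exact (hx (none_mem_newSide hT)).elim
  · rw [some_mem_newSide_iff] at hx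
    refine Reachable.trans ?_ (reachable_some_branch hT w)
    by_cases hw : w = q
    · rw [hw, branch_self]
    · have hadj := adj_branch hT hw
      exact Adj.reachable (deleteEdges_adj.2
        ⟨⟨hadj, fun h => hx h.2, fun h => hadj.ne h.1.symm⟩, by simp⟩)

theorem newEdge_mem_between_iff (hT : T.IsTree) (hA : A ⊆ T.neighborSet q) {a c : Option W} :
    s(none, some q) ∈ between (splitVertex T q A) a c ↔
      ¬ (a ∈ newSide hT q A ↔ c ∈ newSide hT q A) := by
  constructor
  · rintro ⟨-, h⟩ hac
    by_cases ha : a ∈ newSide hT q A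
    · exact h ((reachable_none_of_mem_newSide hT hA ha).symm.trans
        (reachable_none_of_mem_newSide hT hA (hac.1 ha)))
    · exact h ((reachable_some_of_notMem_newSide hT ha).symm.trans
        (reachable_some_of_notMem_newSide hT fun hc => ha (hac.2 hc)))
  · refine fun h => ⟨Or.inl rfl, fun hr => h (iff_of_reachable (fun x y hxy => ?_) hr)⟩
    obtain ⟨hxy, hne⟩ := deleteEdges_adj.1 hxy
    exact mem_newSide_iff_of_adj hT hA hxy hne

theorem isTree_splitVertex (hT : T.IsTree) (hA : A ⊆ T.neighborSet q) :
    (splitVertex T q A).IsTree := by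
  have : Nonempty (Option W) := ⟨none⟩
  refine ⟨⟨fun a c => ?_⟩, isAcyclic_iff_forall_isBridge.2 fun g hg => ?_⟩
  · have h : (T.deleteEdges (Sym2.map (contract q) '' ∅)).Reachable (contract q a)
        (contract q c) := by
      rw [Set.image_empty, deleteEdges_empty]
      exact hT.connected.preconnected _ _
    simpa only [deleteEdges_empty] using
      reachable_of_reachable_contract (A := A) (Set.notMem_empty s(none, some q)) h
  · by_cases hne : g = s(none, some q)
    · rw [hne, isBridge_iff]
      refine ((newEdge_mem_between_iff hT hA).2 fun h => ?_).2
      exact branch_self_notMem hT hA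
        ((some_mem_newSide_iff hT).1 (h.1 (none_mem_newSide hT)))
    · have hbridge := isAcyclic_iff_forall_isBridge.1 hT.isAcyclic
        (map_contract_mem_edgeSet hA hg hne)
      induction g with
      | h x y =>
        rw [isBridge_iff]
        exact fun hr => isBridge_iff.1 hbridge (reachable_contract hA hg hne hr)

open Classical in
/-- The end `x` of the path from `x` to `z` after splitting `q`: a path that starts at `q` keeps
its first edge and does not use the new one. -/
noncomputable def splitEnd (hT : T.IsTree) (q : W) (A : Set W) (x z : W) : Option W :=
  if x = q ∧ branch hT q z ∈ A then none else some x

theorem contract_splitEnd (hT : T.IsTree) (x z : W) : contract q (splitEnd hT q A x z) = x := by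
  unfold splitEnd
  split_ifs with h
  exacts [h.1.symm, rfl]

theorem splitEnd_mem_newSide_iff (hT : T.IsTree) {x z : W} :
    splitEnd hT q A x z ∈ newSide hT q A ↔
      branch hT q x ∈ A ∨ (x = q ∧ branch hT q z ∈ A) := by
  unfold splitEnd
  split_ifs with h
  · exact iff_of_true (none_mem_newSide hT) (Or.inr h)
  · rw [some_mem_newSide_iff, or_iff_left h]

theorem exists_of_newEdge_mem_between (hT : T.IsTree) (hA : A ⊆ T.neighborSet q) {x z : W}
    (h : s(none, some q) ∈
      between (splitVertex T q A) (splitEnd hT q A x z) (splitEnd hT q A z x)) :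
    ∃ y ∈ A, ∃ y' ∉ A, s(q, y) ∈ between T x z ∧ s(q, y') ∈ between T x z := by
  rw [newEdge_mem_between_iff hT hA, splitEnd_mem_newSide_iff, splitEnd_mem_newSide_iff] at h
  wlog hx : branch hT q x ∈ A generalizing x z
  · rw [between_comm]
    exact this (by rwa [iff_comm]) (by tauto)
  have hxq : x ≠ q := fun hxq => branch_self_notMem hT hA (hxq ▸ hx)
  have hz : branch hT q z ∉ A := by tauto
  have hzq : z ≠ q := by tauto
  have hne : branch hT q x ≠ branch hT q z := fun heq => hz (heq ▸ hx)
  refine ⟨_, hx, _, hz, ?_, ?_⟩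
  · rw [mk_mem_between_iff hT (adj_branch hT hxq)]
    exact fun h => hne (h.1 rfl).symm
  · rw [mk_mem_between_iff hT (adj_branch hT hzq)]
    exact fun h => hne (h.2 rfl)

theorem HellyRep.of_forall_exists {W' : Type*} {G : SimpleGraph V} {T' : SimpleGraph W'}
    {s t : V → W} {s' t' : V → W'} (h : HellyRep G T s t)
    (hup : ∀ g ∈ T.edgeSet, ∃ g', ∀ v,
      g ∈ between T (s v) (t v) → g' ∈ between T' (s' v) (t' v))
    (hdown : ∀ g' ∈ T'.edgeSet, ∃ g, ∀ v,
      g' ∈ between T' (s' v) (t' v) → g ∈ between T (s v) (t v)) : HellyRep G T' s' t' := by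
  have hinter {v w : V} : (between T (s v) (t v) ∩ between T (s w) (t w)).Nonempty ↔
      (between T' (s' v) (t' v) ∩ between T' (s' w) (t' w)).Nonempty := by
    constructor
    · rintro ⟨g, hv, hw⟩
      obtain ⟨g', hg'⟩ := hup g hv.1
      exact ⟨g', hg' v hv, hg' w hw⟩
    · rintro ⟨g', hv, hw⟩
      obtain ⟨g, hg⟩ := hdown g' hv.1
      exact ⟨g, hg v hv, hg w hw⟩
  refine ⟨fun x y hxy => (h.adj_iff x y hxy).trans hinter, fun I hI hp => ?_⟩
  obtain ⟨g, hg⟩ := h.helly I hI fun v hv w hw hne => hinter.2 (hp hv hw hne)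
  rw [Set.mem_iInter₂] at hg
  obtain ⟨v, hv⟩ := hI
  obtain ⟨g', hg'⟩ := hup g (hg v hv).1
  exact ⟨g', Set.mem_iInter₂.2 fun w hw => hg' w (hg w hw)⟩

/-- The paths that use the new edge keep a common edge, namely the one from `q` to `a`. -/
theorem HellyRep.splitVertex {G : SimpleGraph V} {s t : V → W} (hT : T.IsTree)
    (h : HellyRep G T s t) (hA : A ⊆ T.neighborSet q) (a : W)
    (ha : ∀ v, ∀ y ∈ A, ∀ y' ∉ A, Uses T s t q v y → Uses T s t q v y' → Uses T s t q v a) :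
    HellyRep G (splitVertex T q A) (fun v => splitEnd hT q A (s v) (t v))
      (fun v => splitEnd hT q A (t v) (s v)) := by
  refine h.of_forall_exists (fun g hg => ?_) fun g' hg' => ?_
  · obtain ⟨g', hg', rfl⟩ := exists_map_contract_eq (q := q) (A := A) hg
    have hne : g' ≠ s(none, some q) := by
      rintro rfl
      exact T.irrefl hg
    refine ⟨g', fun v hv => ?_⟩
    rwa [mem_between_splitVertex_iff hA hg' hne, contract_splitEnd, contract_splitEnd]
  · by_cases hne : g' = s(none, some q)
    · refine ⟨s(q, a), fun v hv => ?_⟩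
      obtain ⟨y, hy, y', hy', hvy, hvy'⟩ := exists_of_newEdge_mem_between hT hA (hne ▸ hv)
      exact ha v y hy y' hy' hvy hvy'
    · refine ⟨g'.map (contract q), fun v hv => ?_⟩
      rwa [mem_between_splitVertex_iff hA hg' hne, contract_splitEnd, contract_splitEnd] at hv

theorem ncard_neighborSet_none [Finite W] (hA : A ⊆ T.neighborSet q) :
    ((splitVertex T q A).neighborSet none).ncard = A.ncard + 1 := by
  have hqA : q ∉ A := fun h => (hA h).ne rfl
  have heq : (splitVertex T q A).neighborSet none = some '' (insert q A) := by
    ext (_ | w)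
    · simp only [SimpleGraph.irrefl, mem_neighborSet, Set.mem_image, reduceCtorEq, and_false,
        exists_false]
    · simp only [mem_neighborSet, splitVertex_adj_none_some, Set.mem_image, Set.mem_insert_iff,
        Option.some.injEq, exists_eq_right]
  rw [heq, Set.ncard_image_of_injective _ (Option.some_injective W),
    Set.ncard_insert_of_notMem hqA (Set.toFinite _)]

theorem ncard_neighborSet_some_self [Finite W] (hA : A ⊆ T.neighborSet q) :
    ((splitVertex T q A).neighborSet (some q)).ncard = (T.neighborSet q \ A).ncard + 1 := by
  have hqA : q ∉ A := fun h => (hA h).ne rfl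
  have heq : (splitVertex T q A).neighborSet (some q) =
      insert none (some '' (T.neighborSet q \ A)) := by
    ext (_ | w)
    · exact iff_of_true (Or.inl rfl) (Or.inl rfl)
    · simp only [mem_neighborSet, splitVertex_adj_some_some, Set.mem_insert_iff, reduceCtorEq,
        false_or, Set.mem_image, Option.some.injEq, exists_eq_right, Set.mem_sdiff]
      tauto
  rw [heq, Set.ncard_insert_of_notMem (by simp) (Set.toFinite _),
    Set.ncard_image_of_injective _ (Option.some_injective W)]

theorem ncard_neighborSet_some (hA : A ⊆ T.neighborSet q) {w : W} (hw : w ≠ q) :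
    ((splitVertex T q A).neighborSet (some w)).ncard = (T.neighborSet w).ncard := by
  have hne {x : Option W} : s(some w, x) ≠ s(none, some q) := fun h => by
    simp only [Sym2.eq_iff, reduceCtorEq, false_and, Option.some.injEq, hw, or_self] at h
  have himage : contract q '' (splitVertex T q A).neighborSet (some w) = T.neighborSet w := by
    ext x
    constructor
    · rintro ⟨x, hx, rfl⟩
      exact map_contract_mem_edgeSet hA hx hne
    · intro hx
      by_cases hxq : x = q ∧ w ∈ A
      · exact ⟨none, Or.inr hxq.2, hxq.1.symm⟩
      · exact ⟨some x, ⟨hx, fun h => hw h.1, hxq⟩, rfl⟩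
  rw [← himage, Set.InjOn.ncard_image]
  intro x hx y hy hxy
  exact Sym2.congr_right.1 (injOn_map_contract ⟨hx, hne⟩ ⟨hy, hne⟩
    (congrArg (fun z => s(w, z)) hxy))

end SplitVertex

section HostTrees

variable {V : Type u} {W : Type v} {G : SimpleGraph V} {T : SimpleGraph W} {s t : V → W}

/-- `A` is a union of components of the link graph after the removal of a cut vertex `a`. -/
theorem exists_subset_of_not_twoConnected {inc : V → W → Prop} {N : Set W}
    (hinc : ∀ v y, inc v y → y ∈ N) (hN : 4 ≤ N.ncard) (h : ¬ TwoConnected inc N Set.univ) :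
    ∃ A ⊆ N, 2 ≤ A.ncard ∧ 2 ≤ (N \ A).ncard ∧
      ∃ a, ∀ v, ∀ y ∈ A, ∀ y' ∉ A, inc v y → inc v y' → inc v a := by
  have hfin : N.Finite := Set.finite_of_ncard_pos (by omega)
  simp only [TwoConnected, not_forall] at h
  obtain ⟨a, haN, y, hyN, z, hzN, hya, hza, hyz⟩ := h
  let R (x : W) : Prop := ((linkGraph inc Set.univ).deleteIncidenceSet a).Reachable y x
  have reachable_iff {v x x'} (hx : inc v x) (hx' : inc v x') (hxa : x ≠ a) (hxa' : x' ≠ a) :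
      R x ↔ R x' := by
    by_cases hne : x = x'
    · rw [hne]
    · have hadj : ((linkGraph inc Set.univ).deleteIncidenceSet a).Adj x x' :=
        deleteIncidenceSet_adj.2 ⟨⟨hne, v, trivial, hx, hx'⟩, hxa, hxa'⟩
      exact ⟨fun h => h.trans hadj.reachable, fun h => h.trans hadj.symm.reachable⟩
  let B : Set W := {x ∈ N | x ≠ a ∧ R x}
  let C : Set W := {x ∈ N | x ≠ a ∧ ¬ R x}
  have hcard : N.ncard - 1 ≤ B.ncard + C.ncard := by
    rw [← Set.ncard_sdiff_singleton_of_mem haN]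
    refine (Set.ncard_le_ncard ?_ (hfin.subset ?_)).trans (Set.ncard_union_le B C)
    · rintro x ⟨hxN, hxa⟩
      by_cases hx : R x
      exacts [Or.inl ⟨hxN, hxa, hx⟩, Or.inr ⟨hxN, hxa, hx⟩]
    · exact Set.union_subset (fun _ hx => hx.1) fun _ hx => hx.1
  have two_le {D : Set W} {x : W} (haD : a ∉ D) (hxN : x ∈ N) (hxa : x ≠ a) (hxD : x ∉ D) :
      2 ≤ (N \ D).ncard :=
    (Set.one_lt_ncard hfin.sdiff).2 ⟨a, ⟨haN, haD⟩, x, ⟨hxN, hxD⟩, hxa.symm⟩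
  by_cases hB : 2 ≤ B.ncard
  · refine ⟨B, fun x hx => hx.1, hB, two_le (fun h => h.2.1 rfl) hzN hza fun h => hyz h.2.2, a,
      fun v x hx x' hx' hvx hvx' => by_contra fun hva => hx' ?_⟩
    have hxa' : x' ≠ a := fun h => hva (h ▸ hvx')
    exact ⟨hinc v x' hvx', hxa', (reachable_iff hvx hvx' hx.2.1 hxa').1 hx.2.2⟩
  · refine ⟨C, fun x hx => hx.1, by omega, two_le (fun h => h.2.1 rfl) hyN hya fun h => h.2.2 .rfl,
      a, fun v x hx x' hx' hvx hvx' => by_contra fun hva => hx' ?_⟩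
    have hxa' : x' ≠ a := fun h => hva (h ▸ hvx')
    exact ⟨hinc v x' hvx', hxa', fun h => hx.2.2 ((reachable_iff hvx hvx' hx.2.1 hxa').2 h)⟩

/-- The total excess of the vertex degrees over three, which decreases when vertices of larger
degree are split. It is junk on an infinite graph, where the sum may be `0`. -/
noncomputable def degreeExcess (T : SimpleGraph W) : ℕ :=
  ∑ᶠ w, ((T.neighborSet w).ncard - 3)

theorem degreeExcess_splitVertex_lt [Finite W] {q : W} {A : Set W} (hA : A ⊆ T.neighborSet q)
    (hcard : 2 ≤ A.ncard) (hcard' : 2 ≤ (T.neighborSet q \ A).ncard) :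
    degreeExcess (splitVertex T q A) < degreeExcess T := by
  classical
  have := Fintype.ofFinite W
  have hsum := Set.ncard_sdiff_add_ncard_of_subset hA
  have hrest : ∑ w ∈ Finset.univ.erase q, (((splitVertex T q A).neighborSet (some w)).ncard - 3) =
      ∑ w ∈ Finset.univ.erase q, ((T.neighborSet w).ncard - 3) :=
    Finset.sum_congr rfl fun w hw => by rw [ncard_neighborSet_some hA (Finset.ne_of_mem_erase hw)]
  rw [degreeExcess, degreeExcess, finsum_eq_sum_of_fintype, finsum_eq_sum_of_fintype,
    Fintype.sum_option, ncard_neighborSet_none hA,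
    ← Finset.add_sum_erase _ _ (Finset.mem_univ q),
    ← Finset.add_sum_erase _ (fun w => (T.neighborSet w).ncard - 3) (Finset.mem_univ q),
    ncard_neighborSet_some_self hA, hrest]
  omega

theorem HellyRep.exists_degreeExcess_lt [Finite W] (hT : T.IsTree) (hR : HellyRep G T s t) {q : W}
    (hq : 4 ≤ (T.neighborSet q).ncard)
    (hn : ¬ TwoConnected (Uses T s t q) (T.neighborSet q) Set.univ) :
    ∃ (T' : SimpleGraph (Option W)) (s' t' : V → Option W),
      T'.IsTree ∧ HellyRep G T' s' t' ∧ degreeExcess T' < degreeExcess T := by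
  obtain ⟨A, hA, hcard, hcard', a, ha⟩ :=
    exists_subset_of_not_twoConnected (fun _ _ hv => hv.1) hq hn
  exact ⟨_, _, _, isTree_splitVertex hT hA, hR.splitVertex hT hA a ha,
    degreeExcess_splitVertex_lt hA hcard hcard'⟩

theorem HellyRep.exists_forall_ncard_le {h : ℕ} (hh : 3 ≤ h)
    (hgate : ∀ k > h, ∀ S : Set V, ¬ IsKGate k (G.induce S)) [Finite W] (hT : T.IsTree)
    (hR : HellyRep G T s t) :
    ∃ (W' : Type v) (_ : Finite W') (T' : SimpleGraph W') (s' t' : V → W'), T'.IsTree ∧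
      HellyRep G T' s' t' ∧ ∀ w, (T'.neighborSet w).ncard ≤ h := by
  induction hm : degreeExcess T using Nat.strong_induction_on generalizing W with
  | _ m ih =>
    by_cases hle : ∀ w, (T.neighborSet w).ncard ≤ h
    · exact ⟨W, inferInstance, T, s, t, hT, hR, hle⟩
    push Not at hle
    obtain ⟨q, hq⟩ := hle
    have hn : ¬ TwoConnected (Uses T s t q) (T.neighborSet q) Set.univ := fun hc =>
      have ⟨S, hS⟩ := hc.exists_isKGate (hR.localStar hT q) (fun _ _ hv => hv.1) (by omega)
      hgate _ hq S hS
    obtain ⟨T', s', t', hT', hR', hlt⟩ := hR.exists_degreeExcess_lt hT (by omega) hn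
    exact ih _ (hm ▸ hlt) hT' hR' rfl

/-- Splitting off no neighbor attaches a leaf. -/
theorem HellyRep.exists_ncard_eq {h : ℕ} (hh : 0 < h) [Finite W] (hT : T.IsTree)
    (hR : HellyRep G T s t) (hle : ∀ w, (T.neighborSet w).ncard ≤ h) :
    ∃ (W' : Type v) (_ : Finite W') (T' : SimpleGraph W') (s' t' : V → W'), T'.IsTree ∧
      HellyRep G T' s' t' ∧ (∀ w, (T'.neighborSet w).ncard ≤ h) ∧
        ∃ w, (T'.neighborSet w).ncard = h := by
  obtain ⟨q⟩ := hT.nonempty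
  induction hm : h - (T.neighborSet q).ncard generalizing W with
  | zero => exact ⟨W, inferInstance, T, s, t, hT, hR, hle, q, by have := hle q; omega⟩
  | succ m ih =>
    have hA : ∅ ⊆ T.neighborSet q := Set.empty_subset _
    have hself := ncard_neighborSet_some_self hA
    rw [Set.sdiff_empty] at hself
    refine ih (isTree_splitVertex hT hA) (hR.splitVertex hT hA q fun _ _ hy => hy.elim) ?_
      (some q) (by omega)
    rintro (_ | w)
    · rw [ncard_neighborSet_none hA, Set.ncard_empty]
      omega
    · by_cases hw : w = q
      · subst hw
        omega
      · rw [ncard_neighborSet_some hA hw]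
        exact hle w

theorem maxDegree_eq_iff [Fintype W] [Nonempty W] [DecidableRel T.Adj] {h : ℕ} :
    T.maxDegree = h ↔
      (∀ w, (T.neighborSet w).ncard ≤ h) ∧ ∃ w, (T.neighborSet w).ncard = h := by
  have hdeg (w : W) : (T.neighborSet w).ncard = T.degree w := by
    rw [Set.ncard_eq_toFinset_card', degree, neighborFinset]
  simp only [hdeg]
  constructor
  · rintro rfl
    obtain ⟨w, hw⟩ := T.exists_maximal_degree_vertex
    exact ⟨T.degree_le_maxDegree, w, hw.symm⟩
  · rintro ⟨hle, w, rfl⟩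
    exact le_antisymm (T.maxDegree_le_of_forall_degree_le _ hle) (T.degree_le_maxDegree w)

theorem isHellyEPTOfMaxDegree_iff {h : ℕ} :
    IsHellyEPTOfMaxDegree G h ↔
      ∃ (W : Type) (_ : Finite W) (T : SimpleGraph W) (s t : V → W), T.IsTree ∧
        HellyRep G T s t ∧ (∀ w, (T.neighborSet w).ncard ≤ h) ∧
          ∃ w, (T.neighborSet w).ncard = h := by
  classical
  constructor
  · rintro ⟨W, _, T, hT, hdeg, R, hR⟩
    have := hT.nonempty
    exact ⟨W, inferInstance, T, _, _, hT, hellyRep_of_isHelly hT R hR, maxDegree_eq_iff.1 hdeg⟩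
  · rintro ⟨W, _, T, s, t, hT, hR, hdeg⟩
    have := hT.nonempty
    have := Fintype.ofFinite W
    exact ⟨W, inferInstance, T, hT, maxDegree_eq_iff.2 hdeg, hR.exists_isHelly hT⟩

end HostTrees

end HellyEPT

open HellyEPT in
theorem theorem3_general {V : Type u} (G : SimpleGraph V) (hG : IsHellyEPT G)
    (h : ℕ) (hh : 3 ≤ h) :
    ¬ IsHellyEPTOfMaxDegree G h ↔
      ∃ k : ℕ, h < k ∧ ∃ S : Set V, IsKGate k (G.induce S) := by
  constructor
  · intro hn
    by_contra! hgate
    obtain ⟨W, _, T, hT, R, hR⟩ := hG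
    obtain ⟨W, _, T, s, t, hT, hR, hle⟩ :=
      (hellyRep_of_isHelly hT R hR).exists_forall_ncard_le hh hgate hT
    exact hn (isHellyEPTOfMaxDegree_iff.2 (hR.exists_ncard_eq (by omega) hT hle))
  · rintro ⟨k, hk, S, hS, rfl⟩ hmem
    obtain ⟨W, _, T, s, t, hT, hR, hle, -⟩ := isHellyEPTOfMaxDegree_iff.1 hmem
    obtain ⟨q, hq⟩ := hS.ncard_maximal_isClique_le hT (hR.comp (SimpleGraph.Embedding.induce S))
    exact (hk.trans_le hq).not_ge (hle q)

theorem theorem3 {V : Type u} [Finite V] (G : SimpleGraph V) (hG : IsHellyEPT G)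
    (h : ℕ) (hh : 3 ≤ h) :
    ¬ IsHellyEPTOfMaxDegree G h ↔
      ∃ k : ℕ, h < k ∧ ∃ S : Set V, IsKGate k (G.induce S) :=
  theorem3_general G hG h hh
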